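/- Setting. For $W\in\mathbb R^{m\times c\times(2s+1)}$ and $x\in\mathbb R^{c\times D}$ (positions taken modulo $D$) let $(W*x)_{r,j}=\sum_{k=1}^{c}\sum_{l=-s}^{s}W_{rk,l}\,x_{k,j+l}$, and for $a\in\mathbb R^m$ let $$f_{a,W}(x)=\frac1{\sqrt m}\sum_{r=1}^m a_r\,\frac1D\sum_{j=1}^D\max\{(W*x)_{r,j},0\}$$ be the one-hidden-layer ReLU convolutional network with average pooling and $m$ filters. Let $S=\{(x_i,y_i)\}_{i=1}^n$, $n\ge1$, be a data set with $|y_i|\le B$, all of whose patches $\phi_j(x_i)=(x_{i;k,j+l})_{1\le k\le c,\,|l|\le s}$ have norm $1$. Let $p\in[0,1)$ be the pruning rate, $q=1-p$, and suppose that $M=qm$ is an integer. Assume that the matrix $$G^\infty_{ii'}=\mathbb E_{w\sim N(0,I)}\Big[\frac q{D^2}\sum_{j,j'=1}^D\langle\phi_j(x_i),\phi_{j'}(x_{i'})\rangle\,\mathbf 1\{\langle w,\phi_j(x_i)\rangle\ge0,\ \langle w,\phi_{j'}(x_{i'})\rangle\ge0\}\Big]$$ has a positive least eigenvalue $\lambda_0$.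 Initialization: $a_0$ is uniform on $\{-1,1\}^m$ and, independently, $W_0$ has independent standard Gaussian entries. Pre-training: $W_{pre}$ is obtained from $W_0$ by any number of gradient descent steps with learning rate $\eta_{pre}$ on the loss $\frac12\sum_i(f_{a_0,W}(x_i)-y_i)^2$, with $a_0$ frozen and the derivative of the ReLU at $0$ taken to be $1$. Structured pruning: $M$ of the $m$ filters are kept and the others are removed; the kept filters may be chosen at random and may depend on the pre-trained model, but, listed in some order, their initial parameters (entries of $W_0$ and $a_0$) are again independent standard Gaussians and independent uniform signs, as is the case for instance whenever the choice is independent of $(a_0,W_0)$. Fine-tuning: the kept filters are reset to their values in $W_0$, and $W_{fin}$ is obtained by any number of gradient descent steps with learning rate $\eta$ on the same loss for the pruned network (same factor $1/\sqrt m$, kept entries of $a_0$ frozen); the pruned filters of $W_{fin}\in\mathbb R^{m\times c\times(2s+1)}$ are zero. Claim. There are absolute constants $k\in\mathbb N$ and $c_0>0$, and for all $p\in[0,1)$ and $B\ge0$ a constant $C=C(p,B)>0$, such that in the above setting, for every $\delta\in(0,1)$, if $$m\ge\frac{C}{\delta^2}\Big(\frac n{\lambda_0}\Big)^{k}\qquad\text{and}\qquad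 0<\eta,\ \eta_{pre}\le\frac{c_0\lambda_0}{n^2},$$ then with probability at least $1-\delta$, simultaneously for all numbers of pre-training and fine-tuning steps, $$\min_{Q\in\mathbb O}\ \frac{\|QW_{fin}-W_{pre}\|}{\sqrt{\|QW_{fin}\|\,\|W_{pre}\|}}\ \ge\ \frac p2,$$ where $\|\cdot\|$ is the $\ell_2$ norm and $\mathbb O$ is the group of all linear isometries of the space of tensors $\mathbb R^{m\times c\times(2s+1)}$. -/

import Mathlib

open MeasureTheory ProbabilityTheory
open scoped RealInnerProductSpace

noncomputable section

namespace ORCNN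

/-- Convolution tensors with `m` output channels (filters), `c` input channels and kernel size
`2 s + 1`, with the standard `ℓ₂` norm and inner product. -/
abbrev ConvTensor (m c s : ℕ) : Type :=
  EuclideanSpace ℝ (Fin m × Fin c × Fin (2 * s + 1))

/-- A single filter, or a patch of the input: a `c × (2 s + 1)` array with the `ℓ₂` structure. -/
abbrev Patch (c s : ℕ) : Type :=
  EuclideanSpace ℝ (Fin c × Fin (2 * s + 1))

/-- Inputs with `c` channels and length `D`. Positions live in `ZMod D`: this is the circular
padding convention `x_{k, j + D} = x_{k, j}`. -/
abbrev Input (c D : ℕ) : Type :=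
  Fin c → ZMod D → ℝ

/-- The window of width `2 s + 1` of the input `x` around position `j`: its `(k, l)` entry is
`x_{k, j + l}`, where the index `l : Fin (2 s + 1)` stands for the offset `l - s`. -/
def patch {c D : ℕ} (s : ℕ) (x : Input c D) (j : ZMod D) : Patch c s :=
  WithLp.toLp 2 fun kl => x kl.1 (j + (((kl.2 : ℕ) : ZMod D) - (s : ZMod D)))

/-- Convolution `W * x`: output channel `r`, position `j`. -/
def conv {m c s D : ℕ} (W : ConvTensor m c s) (x : Input c D) (r : Fin m) (j : ZMod D) : ℝ :=
  ∑ k : Fin c, ∑ l : Fin (2 * s + 1),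
    W (r, k, l) * x k (j + (((l : ℕ) : ZMod D) - (s : ZMod D)))

/-- The ReLU activation. -/
def relu (z : ℝ) : ℝ := max z 0

/-- The derivative of the ReLU, with the convention that it equals `1` at `0`. -/
def reluDeriv (z : ℝ) : ℝ := if 0 ≤ z then 1 else 0

/-- Average pooling over the positions. -/
def avgPool {m D : ℕ} [NeZero D] (v : Fin m → ZMod D → ℝ) (r : Fin m) : ℝ :=
  (1 / (D : ℝ)) * ∑ j : ZMod D, v r j

/-- The one-hidden-layer ReLU convolutional network with average pooling, with `m` filters and
fully connected weights `a`. The feature map is scaled by `1 / √N`; the original network of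
width `m` has `N = m`, and the network that is left when filters are removed from a network of
width `N` keeps the factor `1 / √N`. -/
def net (N : ℕ) {m c s D : ℕ} [NeZero D] (a : Fin m → ℝ) (W : ConvTensor m c s)
    (x : Input c D) : ℝ :=
  ∑ r : Fin m, a r * avgPool (fun r j => (1 / √(N : ℝ)) * relu (conv W x r j)) r

/-- The squared loss on the data set `(x i, y i)`. -/
def loss (N : ℕ) {m c s D n : ℕ} [NeZero D] (a : Fin m → ℝ) (x : Fin n → Input c D)
    (y : Fin n → ℝ) (W : ConvTensor m c s) : ℝ :=
  (1 / 2) * ∑ i : Fin n, (net N a W (x i) - y i) ^ 2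

/-- The gradient `∂L/∂W` of the squared loss with respect to the convolution tensor, with
`reluDeriv` as the derivative of the ReLU (see `hasGradientAt_loss`). -/
def lossGrad (N : ℕ) {m c s D n : ℕ} [NeZero D] (a : Fin m → ℝ) (x : Fin n → Input c D)
    (y : Fin n → ℝ) (W : ConvTensor m c s) : ConvTensor m c s :=
  WithLp.toLp 2 fun rkl => ∑ i : Fin n, (net N a W (x i) - y i) *
    (a rkl.1 * ((1 / (D : ℝ)) * ∑ j : ZMod D,
      (1 / √(N : ℝ)) * (reluDeriv (conv W (x i) rkl.1 j) * patch s (x i) j rkl.2)))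

/-- Gradient descent on the convolution tensor with learning rate `η`, from `W₀`, with the fully
connected weights `a` frozen: the tensor after `t` steps. -/
def gradDescent (N : ℕ) {m c s D n : ℕ} [NeZero D] (a : Fin m → ℝ) (x : Fin n → Input c D)
    (y : Fin n → ℝ) (η : ℝ) (W₀ : ConvTensor m c s) : ℕ → ConvTensor m c s
  | 0 => W₀
  | t + 1 => gradDescent N a x y η W₀ t - η • lossGrad N a x y (gradDescent N a x y η W₀ t)

/-- The filters of `W` listed by `κ`. -/
def keepFilters {m M c s : ℕ} (κ : Fin M ↪ Fin m) (W : ConvTensor m c s) : ConvTensor M c s :=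
  WithLp.toLp 2 fun rkl => W (κ rkl.1, rkl.2)

/-- The convolution tensor with `m` filters whose filter `κ r` is the filter `r` of `V`, and whose
other (pruned) filters are zero. -/
def zeroPad {m M c s : ℕ} (κ : Fin M ↪ Fin m) (V : ConvTensor M c s) : ConvTensor m c s :=
  WithLp.toLp 2 fun rkl => Function.extend κ (fun r => V (r, rkl.2)) 0 rkl.1

/-- The law of the random initialization of a network with `m` filters: independent uniform signs
for the fully connected weights, and independently of them independent standard Gaussian entries
for the convolution tensor. -/
def initLaw (m c s : ℕ) : Measure ((Fin m → ℝ) × ConvTensor m c s) :=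
  (Measure.pi fun _ : Fin m => uniformOn ({-1, 1} : Set ℝ)).prod
    (stdGaussian (ConvTensor m c s))

/-- The limiting Gram matrix `G^∞` of the network of which the fraction `q` of the filters is
kept: the expectation is over one filter `w` with independent standard Gaussian entries. -/
def gramLimit {c D n : ℕ} [NeZero D] (s : ℕ) (q : ℝ) (x : Fin n → Input c D) :
    Matrix (Fin n) (Fin n) ℝ :=
  Matrix.of fun i i' => ∫ w : Patch c s, q / (D : ℝ) ^ 2 * ∑ j : ZMod D, ∑ j' : ZMod D,
    ⟪patch s (x i) j, patch s (x i') j'⟫ *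
      (reluDeriv ⟪w, patch s (x i) j⟫ * reluDeriv ⟪w, patch s (x i') j'⟫)
    ∂(stdGaussian (Patch c s))

/-- The normalized `ℓ₂` distance of two tensors. -/
def normDist {m c s : ℕ} (A B : ConvTensor m c s) : ℝ :=
  ‖A - B‖ / √(‖A‖ * ‖B‖)

/-- The minimal normalized `ℓ₂` distance of `B` to a rotation `Q A` of `A`. The rotations are all
linear isometries of the space of convolution tensors. -/
def minRotDist {m c s : ℕ} (A B : ConvTensor m c s) : ℝ :=
  ⨅ Q : ConvTensor m c s ≃ₗᵢ[ℝ] ConvTensor m c s, normDist (Q A) B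

/-- Where no preactivation vanishes, `lossGrad` is the gradient of the loss. -/
theorem hasGradientAt_loss (N : ℕ) {m c s D n : ℕ} [NeZero D] (a : Fin m → ℝ)
    (x : Fin n → Input c D) (y : Fin n → ℝ) (W : ConvTensor m c s)
    (hW : ∀ i r j, conv W (x i) r j ≠ 0) :
    HasGradientAt (loss N a x y) (lossGrad N a x y W) W := by
  have hrelu : ∀ z : ℝ, z ≠ 0 → HasDerivAt relu (reluDeriv z) z := by
    intro z hz
    rcases lt_or_gt_of_ne hz with h | h
    · have h0 : reluDeriv z = 0 := by simp [reluDeriv, h]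
      rw [h0]
      refine (hasDerivAt_const z (0 : ℝ)).congr_of_eventuallyEq ?_
      filter_upwards [Iio_mem_nhds h] with w hw
      exact max_eq_right (le_of_lt hw)
    · have h1 : reluDeriv z = 1 := by simp [reluDeriv, h.le]
      rw [h1]
      refine (hasDerivAt_id z).congr_of_eventuallyEq ?_
      filter_upwards [Ioi_mem_nhds h] with w hw
      exact max_eq_left (le_of_lt hw)
  have hconv : ∀ (z : Input c D) (r : Fin m) (j : ZMod D),
      HasFDerivAt (fun V : ConvTensor m c s => conv V z r j)
        (∑ k : Fin c, ∑ l : Fin (2 * s + 1), (patch s z j (k, l)) •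
          (EuclideanSpace.proj (r, k, l) : ConvTensor m c s →L[ℝ] ℝ)) W := by
    intro z r j
    unfold conv
    refine HasFDerivAt.fun_sum fun k _ => HasFDerivAt.fun_sum fun l _ => ?_
    exact ((EuclideanSpace.proj (r, k, l) : ConvTensor m c s →L[ℝ] ℝ).hasFDerivAt).mul_const _
  have hnet : ∀ i, HasFDerivAt (fun V : ConvTensor m c s => net N a V (x i))
      (∑ r : Fin m, a r • ((1 / (D : ℝ)) • ∑ j : ZMod D, (1 / √(N : ℝ)) •
        (reluDeriv (conv W (x i) r j) • ∑ k : Fin c, ∑ l : Fin (2 * s + 1),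
          (patch s (x i) j (k, l)) •
            (EuclideanSpace.proj (r, k, l) : ConvTensor m c s →L[ℝ] ℝ)))) W := by
    intro i
    unfold net avgPool
    refine HasFDerivAt.fun_sum fun r _ => HasFDerivAt.const_mul ?_ _
    refine HasFDerivAt.const_mul ?_ _
    refine HasFDerivAt.fun_sum fun j _ => HasFDerivAt.const_mul ?_ _
    exact (hrelu _ (hW i r j)).comp_hasFDerivAt W (hconv (x i) r j)
  have hloss : HasFDerivAt (loss N a x y) ((1 / 2 : ℝ) • ∑ i : Fin n,
      ((2 * (net N a W (x i) - y i)) • (∑ r : Fin m, a r • ((1 / (D : ℝ)) • ∑ j : ZMod D,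
        (1 / √(N : ℝ)) • (reluDeriv (conv W (x i) r j) • ∑ k : Fin c, ∑ l : Fin (2 * s + 1),
          (patch s (x i) j (k, l)) •
            (EuclideanSpace.proj (r, k, l) : ConvTensor m c s →L[ℝ] ℝ)))))) W := by
    unfold loss
    refine HasFDerivAt.const_mul ?_ _
    refine HasFDerivAt.fun_sum fun i _ => ?_
    have := ((hnet i).sub_const (y i)).pow 2
    simpa using this
  rw [hasGradientAt_iff_hasFDerivAt]
  refine hloss.congr_fderiv ?_
  ext v
  rw [InnerProductSpace.toDual_apply_apply, PiLp.inner_apply, Fintype.sum_prod_type]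
  simp only [lossGrad, smul_apply, sum_apply, smul_eq_mul, PiLp.proj_apply,
    Fintype.sum_prod_type, RCLike.inner_apply, conj_trivial, Finset.mul_sum]
  rw [Finset.sum_comm]
  refine Finset.sum_congr rfl fun r _ => ?_
  have hcomm : ∀ g : Fin n → ZMod D → Fin c → Fin (2 * s + 1) → ℝ,
      ∑ i, ∑ j, ∑ k, ∑ l, g i j k l = ∑ k, ∑ l, ∑ i, ∑ j, g i j k l := by
    intro g
    have h1 : ∀ i, ∑ j, ∑ k, ∑ l, g i j k l = ∑ k, ∑ l, ∑ j, g i j k l := by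
      intro i
      rw [Finset.sum_comm]
      exact Finset.sum_congr rfl fun k _ => Finset.sum_comm
    rw [Finset.sum_congr rfl fun i _ => h1 i, Finset.sum_comm]
    exact Finset.sum_congr rfl fun k _ => Finset.sum_comm
  rw [hcomm]
  refine Finset.sum_congr rfl fun k _ => Finset.sum_congr rfl fun l _ =>
    Finset.sum_congr rfl fun i _ => Finset.sum_congr rfl fun j _ => ?_
  ring

end ORCNN

end

/-! The bound comes from norms alone. Isometries preserve norms, so `normDist (Q A) B` is at least
(‖B‖ - ‖A‖) / √(‖A‖ ‖B‖) for every Q. Put d = c (2 s + 1) and q = 1 - p. A Gaussian tensor with m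
filters has norm about √(m d), and its q m kept filters have norm about √(q m d). If training hardly
changes these norms, the distance is at least about (1 - √q) / q^(1/4), which exceeds p / 2 = (1 -
√q)(1 + √q) / 2 with room for errors when p > 0 (`half_le_minRotDist`).

That training is lazy is the neural tangent kernel argument. Suppose that the kernel at
initialization has least eigenvalue at least 3λ/4 and that few activations can flip while every
filter moves by at most R (`WellSpread`). Then each gradient step contracts the residual by 1 -
ηλ/4, the steps are dominated by a geometric series, and no filter ever leaves its ball of radius R
(`WellSpread.norm_gradDescent_sub_le`). With R a small multiple of λ/n the tensor moves by at most
√m R, which is small against √(m d). This part is deterministic, hence holds for all numbers of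
steps at once.

The conditions at initialization follow from Chebyshev's inequality for the kernel entries, the
instabilities, the outputs and the squared norm (`exists_initLaw_event`); the failure probability is
1/m times a polynomial in n and 1/λ. This is applied to the full network and to the kept filters.
Only the law of the kept filters enters, and a union bound makes their dependence on the full
network irrelevant. -/

noncomputable section

namespace ORCNN

/-! ### Pooled ReLU responses of one filter and their linearization -/

section Deterministic

variable {V : Type*} [NormedAddCommGroup V] [InnerProductSpace ℝ V]
variable {J : Type*} [Fintype J]

/-- The pooled ReLU response of the filter `w` on the patches `z`. -/
def pool (z : J → V) (w : V) : ℝ := (Fintype.card J : ℝ)⁻¹ * ∑ j, relu ⟪w, z j⟫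

/-- The gradient of `pool z` at `w`. -/
def feat (z : J → V) (w : V) : V :=
  (Fintype.card J : ℝ)⁻¹ • ∑ j, reluDeriv ⟪w, z j⟫ • z j

/-- The fraction of the patches `z` whose activation at `w` may change when the filter moves by at
most `R`. -/
def unstable (R : ℝ) (z : J → V) (w : V) : ℝ :=
  (Fintype.card J : ℝ)⁻¹ * ∑ j, if |⟪w, z j⟫| ≤ R then 1 else 0

lemma unstable_nonneg (R : ℝ) (z : J → V) (w : V) : 0 ≤ unstable R z w := by
  unfold unstable
  have : ∀ j, (0 : ℝ) ≤ if |⟪w, z j⟫| ≤ R then 1 else 0 := fun j => by split_ifs <;> norm_num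
  have := Finset.sum_nonneg fun j (_ : j ∈ Finset.univ) => this j
  positivity

lemma inv_card_mul_sum_le_one {g : J → ℝ} (hg : ∀ j, g j ≤ 1) :
    (Fintype.card J : ℝ)⁻¹ * ∑ j, g j ≤ 1 := by
  have h : ∑ j, g j ≤ Fintype.card J := by
    simpa using Finset.sum_le_sum fun j (_ : j ∈ Finset.univ) => hg j
  calc _ ≤ (Fintype.card J : ℝ)⁻¹ * Fintype.card J := by gcongr
    _ ≤ 1 := inv_mul_le_one

lemma abs_reluDeriv_le_one (x : ℝ) : |reluDeriv x| ≤ 1 := by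
  unfold reluDeriv; split_ifs <;> norm_num

lemma norm_inv_card_smul_sum_le {g : J → V} {h : J → ℝ} (hg : ∀ j, ‖g j‖ ≤ h j) :
    ‖(Fintype.card J : ℝ)⁻¹ • ∑ j, g j‖ ≤ (Fintype.card J : ℝ)⁻¹ * ∑ j, h j := by
  rw [norm_smul, Real.norm_of_nonneg (by positivity)]
  gcongr
  exact norm_sum_le_of_le _ fun j _ => hg j

lemma norm_feat_le_one {z : J → V} (hz : ∀ j, ‖z j‖ = 1) (w : V) : ‖feat z w‖ ≤ 1 := by
  refine (norm_inv_card_smul_sum_le (h := fun _ => 1) fun j => ?_).trans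
    (inv_card_mul_sum_le_one fun j => le_rfl)
  rw [norm_smul, hz, mul_one]
  exact abs_reluDeriv_le_one _

lemma abs_inner_sub_le {w w' z : V} (hz : ‖z‖ = 1) : |⟪w', z⟫ - ⟪w, z⟫| ≤ ‖w' - w‖ := by
  rw [← inner_sub_left]
  simpa [hz] using abs_real_inner_le_norm (w' - w) z

/-- Against a unit patch the preactivation moves by at most R, so an activation can flip only if the
initial preactivation is at most R in absolute value. -/
lemma norm_feat_sub_le {z : J → V} (hz : ∀ j, ‖z j‖ = 1) {w w₀ : V} {R : ℝ}
    (hw : ‖w - w₀‖ ≤ R) : ‖feat z w - feat z w₀‖ ≤ unstable R z w₀ := by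
  unfold feat unstable
  rw [← smul_sub, ← Finset.sum_sub_distrib]
  refine norm_inv_card_smul_sum_le fun j => ?_
  rw [← sub_smul, norm_smul, hz, mul_one, Real.norm_eq_abs]
  have h := abs_le.mp ((abs_inner_sub_le (w := w₀) (w' := w) (hz j)).trans hw)
  unfold reluDeriv
  split_ifs with h1 h2 h3 h3 h4 h5 h6 <;> norm_num <;>
  · rw [abs_le] at *
    grind

/-- On a patch that is not unstable both preactivations lie on the same linear piece and the error
vanishes; on an unstable one it is at most the change of the preactivation. This replaces a
curvature bound, which the ReLU does not have. -/
lemma abs_pool_sub_le {z : J → V} (hz : ∀ j, ‖z j‖ = 1) {w w' w₀ : V} {R : ℝ}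
    (hw : ‖w - w₀‖ ≤ R) (hw' : ‖w' - w₀‖ ≤ R) :
    |pool z w' - pool z w - ⟪feat z w, w' - w⟫| ≤ unstable R z w₀ * ‖w' - w‖ := by
  have e : pool z w' - pool z w - ⟪feat z w, w' - w⟫ = (Fintype.card J : ℝ)⁻¹ *
      ∑ j, (relu ⟪w', z j⟫ - relu ⟪w, z j⟫ - reluDeriv ⟪w, z j⟫ * (⟪w', z j⟫ - ⟪w, z j⟫)) := by
    unfold pool feat
    rw [real_inner_smul_left, sum_inner, Finset.sum_sub_distrib, Finset.sum_sub_distrib]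
    simp only [inner_sub_right, real_inner_smul_right, real_inner_comm, mul_sub]
  rw [e, abs_mul, abs_of_nonneg (by positivity), unstable, mul_assoc, Finset.sum_mul]
  gcongr
  refine (Finset.abs_sum_le_sum_abs _ _).trans (Finset.sum_le_sum fun j _ => ?_)
  have h := abs_le.mp ((abs_inner_sub_le (w := w₀) (w' := w) (hz j)).trans hw)
  have h' := abs_le.mp ((abs_inner_sub_le (w := w₀) (w' := w') (hz j)).trans hw')
  have h'' := abs_le.mp ((abs_inner_sub_le (w := w) (w' := w') (hz j)))
  generalize ⟪w, z j⟫ = b at *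
  generalize ⟪w', z j⟫ = b' at *
  generalize ⟪w₀, z j⟫ = b₀ at *
  have hn := norm_nonneg (w' - w)
  generalize ‖w' - w‖ = d at *
  unfold relu reluDeriv
  rcases le_total 0 b with hb | hb <;> rcases le_total 0 b' with hb' | hb' <;>
    simp only [max_eq_left, max_eq_right, hb, hb'] <;> split_ifs with h1 h2 h3 <;>
    rw [abs_le] at * <;> constructor <;> grind

lemma sum_abs_le_sqrt_mul_norm {n : ℕ} (e : EuclideanSpace ℝ (Fin n)) :
    ∑ i, |e i| ≤ √n * ‖e‖ := by
  have h := Finset.sum_mul_sq_le_sq_mul_sq Finset.univ (fun i => |e i|) (fun _ => (1 : ℝ))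
  have h2 : ‖e‖ ^ 2 = ∑ i, |e i| ^ 2 := by
    simp [EuclideanSpace.real_norm_sq_eq]
  refine le_of_sq_le_sq ?_ (by positivity)
  rw [mul_pow, Real.sq_sqrt (by positivity), h2]
  simpa [mul_comm] using h

lemma abs_unstable_le_one (R : ℝ) (z : J → V) (w : V) : |unstable R z w| ≤ 1 := by
  rw [abs_of_nonneg (unstable_nonneg _ _ _)]
  exact inv_card_mul_sum_le_one fun j => by split_ifs <;> norm_num

lemma pool_sq_le (z : J → V) (w : V) :
    pool z w ^ 2 ≤ (Fintype.card J : ℝ)⁻¹ * ∑ j, ⟪w, z j⟫ ^ 2 := by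
  have h1 := Finset.sum_mul_sq_le_sq_mul_sq Finset.univ (fun j => relu ⟪w, z j⟫) (fun _ => (1 : ℝ))
  simp only [mul_one, one_pow, Finset.sum_const, Finset.card_univ, nsmul_eq_mul] at h1
  have h2 : ∑ j, relu ⟪w, z j⟫ ^ 2 ≤ ∑ j, ⟪w, z j⟫ ^ 2 := by
    refine Finset.sum_le_sum fun j _ => ?_
    unfold relu
    rcases le_total 0 ⟪w, z j⟫ with h | h
    · rw [max_eq_left h]
    · rw [max_eq_right h, zero_pow two_ne_zero]; positivity
  -- With no patches the factor is the junk value 0⁻¹ = 0, and both sides vanish.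
  rcases Nat.eq_zero_or_pos (Fintype.card J) with h0 | h0
  · simp [pool, h0]
  have h0' : (0 : ℝ) < Fintype.card J := by exact_mod_cast h0
  unfold pool
  rw [mul_pow]
  calc _ ≤ ((Fintype.card J : ℝ)⁻¹) ^ 2 * ((∑ j, ⟪w, z j⟫ ^ 2) * Fintype.card J) := by
        gcongr
        exact h1.trans (by gcongr)
    _ = _ := by field_simp

end Deterministic

/-! ### Convergence of gradient descent from well spread filters -/

section Deterministic

variable {V : Type*} [NormedAddCommGroup V] [InnerProductSpace ℝ V]
variable {J : Type*} [Fintype J] {n M : ℕ}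

/-- The vector of the errors of the network with filters `w`, output weights `a` and scale `θ`. -/
def residual (θ : ℝ) (a : Fin M → ℝ) (z : Fin n → J → V) (y : Fin n → ℝ) (w : Fin M → V) :
    EuclideanSpace ℝ (Fin n) :=
  WithLp.toLp 2 fun i => θ * ∑ r, a r * pool (z i) (w r) - y i

/-- The gradient of the squared loss with respect to the filter `r`, when the errors are `e`. -/
def filterGrad (θ : ℝ) (a : Fin M → ℝ) (z : Fin n → J → V) (e : EuclideanSpace ℝ (Fin n))
    (w : Fin M → V) (r : Fin M) : V :=
  (θ * a r) • ∑ i, e i • feat (z i) (w r)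

lemma norm_sum_smul_feat_le {z : Fin n → J → V} (hz : ∀ i j, ‖z i j‖ = 1)
    (e : EuclideanSpace ℝ (Fin n)) (v : V) : ‖∑ i, e i • feat (z i) v‖ ≤ ∑ i, |e i| := by
  refine norm_sum_le_of_le _ fun i _ => ?_
  rw [norm_smul, Real.norm_eq_abs]
  exact mul_le_of_le_one_right (abs_nonneg _) (norm_feat_le_one (hz i) v)

lemma norm_filterGrad_le {θ : ℝ} (hθ : 0 ≤ θ) {a : Fin M → ℝ} (ha : ∀ r, a r ^ 2 = 1)
    {z : Fin n → J → V} (hz : ∀ i j, ‖z i j‖ = 1) (e : EuclideanSpace ℝ (Fin n))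
    (w : Fin M → V) (r : Fin M) : ‖filterGrad θ a z e w r‖ ≤ θ * (√n * ‖e‖) := by
  have h : |a r| = 1 := by rw [← sq_eq_sq₀ (abs_nonneg _) zero_le_one, sq_abs, ha, one_pow]
  rw [filterGrad, norm_smul, norm_mul, Real.norm_of_nonneg hθ, Real.norm_eq_abs, h, mul_one]
  gcongr
  exact (norm_sum_smul_feat_le hz e _).trans (sum_abs_le_sqrt_mul_norm e)

/-- Difference of two squares: both norms are at most `∑ i, |e i|`, and their difference is
controlled by the flipped activations. -/
lemma sq_norm_sum_feat_ge {z : Fin n → J → V} (hz : ∀ i j, ‖z i j‖ = 1)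
    (e : EuclideanSpace ℝ (Fin n)) {v v₀ : V} {R : ℝ} (hv : ‖v - v₀‖ ≤ R) :
    ‖∑ i, e i • feat (z i) v₀‖ ^ 2 -
      2 * (∑ i, |e i|) * ∑ i, |e i| * unstable R (z i) v₀ ≤ ‖∑ i, e i • feat (z i) v‖ ^ 2 := by
  set p := ∑ i, e i • feat (z i) v
  set p₀ := ∑ i, e i • feat (z i) v₀
  have h1 : ‖p - p₀‖ ≤ ∑ i, |e i| * unstable R (z i) v₀ := by
    rw [← Finset.sum_sub_distrib]
    refine norm_sum_le_of_le _ fun i _ => ?_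
    rw [← smul_sub, norm_smul, Real.norm_eq_abs]
    gcongr
    exact norm_feat_sub_le (hz i) hv
  have h2 : ‖p‖ ≤ ∑ i, |e i| := norm_sum_smul_feat_le hz e v
  have h3 : ‖p₀‖ ≤ ∑ i, |e i| := norm_sum_smul_feat_le hz e v₀
  have h4 : ‖p₀‖ - ‖p‖ ≤ ‖p - p₀‖ := by rw [norm_sub_rev]; exact norm_sub_norm_le _ _
  have h5 : ‖p₀‖ ^ 2 - ‖p‖ ^ 2 ≤ ‖p - p₀‖ * (2 * ∑ i, |e i|) := by
    calc ‖p₀‖ ^ 2 - ‖p‖ ^ 2 = (‖p₀‖ - ‖p‖) * (‖p₀‖ + ‖p‖) := by ring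
      _ ≤ ‖p - p₀‖ * (‖p₀‖ + ‖p‖) := by gcongr
      _ ≤ _ := by gcongr; linarith
  have h6 : ‖p - p₀‖ * (2 * ∑ i, |e i|) ≤
      (∑ i, |e i| * unstable R (z i) v₀) * (2 * ∑ i, |e i|) := by gcongr
  linarith

/-- The conditions on the initial filters under which gradient descent stays within `R` of them. -/
structure WellSpread (θ lam R : ℝ) (z : Fin n → J → V) (w : Fin M → V) : Prop where
  quad : ∀ e : EuclideanSpace ℝ (Fin n),
    3 / 4 * lam * ‖e‖ ^ 2 ≤ θ ^ 2 * ∑ r, ‖∑ i, e i • feat (z i) (w r)‖ ^ 2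
  unst : ∀ i, θ ^ 2 * ∑ r, unstable R (z i) (w r) ≤ lam / (8 * n)

/-- Passing from the initial kernel to the current one costs at most 2 (∑ |e i|)² · lam / (8 n) ≤
lam / 4 · ‖e‖², by Cauchy–Schwarz; this is taken out of the 3/4 in `quad`. -/
lemma WellSpread.sum_sq_filterGrad_ge {θ lam R : ℝ} (hn : 0 < n) (hlam : 0 < lam)
    {a : Fin M → ℝ} (ha : ∀ r, a r ^ 2 = 1) {z : Fin n → J → V} (hz : ∀ i j, ‖z i j‖ = 1)
    {w₀ w : Fin M → V} (h : WellSpread θ lam R z w₀) (hw : ∀ r, ‖w r - w₀ r‖ ≤ R)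
    (e : EuclideanSpace ℝ (Fin n)) :
    lam / 2 * ‖e‖ ^ 2 ≤ ∑ r, ‖filterGrad θ a z e w r‖ ^ 2 := by
  have hn' : (0 : ℝ) < n := by exact_mod_cast hn
  have e1 : ∑ r, ‖filterGrad θ a z e w r‖ ^ 2 =
      θ ^ 2 * ∑ r, ‖∑ i, e i • feat (z i) (w r)‖ ^ 2 := by
    rw [Finset.mul_sum]
    refine Finset.sum_congr rfl fun r _ => ?_
    rw [filterGrad, norm_smul, mul_pow, Real.norm_eq_abs, sq_abs, mul_pow, ha, mul_one]
  have h1 : θ ^ 2 * ∑ r, (‖∑ i, e i • feat (z i) (w₀ r)‖ ^ 2 -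
      2 * (∑ i, |e i|) * ∑ i, |e i| * unstable R (z i) (w₀ r)) ≤
      θ ^ 2 * ∑ r, ‖∑ i, e i • feat (z i) (w r)‖ ^ 2 := by
    gcongr with r
    exact sq_norm_sum_feat_ge hz e (hw r)
  have h2 : θ ^ 2 * ∑ r, 2 * (∑ i, |e i|) * ∑ i, |e i| * unstable R (z i) (w₀ r) ≤
      lam / 4 * ‖e‖ ^ 2 := by
    calc θ ^ 2 * ∑ r, 2 * (∑ i, |e i|) * ∑ i, |e i| * unstable R (z i) (w₀ r)
        = 2 * (∑ i, |e i|) * ∑ i, |e i| * (θ ^ 2 * ∑ r, unstable R (z i) (w₀ r)) := by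
          rw [← Finset.mul_sum, Finset.sum_comm, mul_left_comm]
          congr 1
          rw [Finset.mul_sum]
          refine Finset.sum_congr rfl fun i _ => ?_
          rw [← Finset.mul_sum]; ring
      _ ≤ 2 * (∑ i, |e i|) * ∑ i, |e i| * (lam / (8 * n)) := by
          gcongr with i
          exact h.unst i
      _ = 2 * (∑ i, |e i|) ^ 2 * (lam / (8 * n)) := by rw [← Finset.sum_mul]; ring
      _ ≤ 2 * (√n * ‖e‖) ^ 2 * (lam / (8 * n)) := by
          gcongr
          exact sum_abs_le_sqrt_mul_norm e
      _ = lam / 4 * ‖e‖ ^ 2 := by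
          rw [mul_pow, Real.sq_sqrt hn'.le]; field_simp; ring
  have h3 := h.quad e
  rw [Finset.sum_sub_distrib, mul_sub] at h1
  rw [e1]
  linarith

/-- One gradient step that stays within `R` of well spread filters contracts the errors. -/
lemma WellSpread.norm_residual_step_le {θ lam R η : ℝ} (hn : 0 < n) (hθ : 0 ≤ θ)
    (hθM : θ ^ 2 * M ≤ 1) (hlam : 0 < lam) (hlam1 : lam ≤ 1) (hη : 0 < η)
    (hη1 : η ≤ 1 / 8 * lam / n ^ 2)
    {a : Fin M → ℝ} (ha : ∀ r, a r ^ 2 = 1) {z : Fin n → J → V} (hz : ∀ i j, ‖z i j‖ = 1)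
    (y : Fin n → ℝ)
    {w₀ w w' : Fin M → V} (h : WellSpread θ lam R z w₀) (hw : ∀ r, ‖w r - w₀ r‖ ≤ R)
    (hw' : ∀ r, ‖w' r - w₀ r‖ ≤ R)
    (hstep : ∀ r, w' r = w r - η • filterGrad θ a z (residual θ a z y w) w r) :
    ‖residual θ a z y w'‖ ≤ (1 - η * lam / 4) * ‖residual θ a z y w‖ := by
  have hn' : (1 : ℝ) ≤ n := by exact_mod_cast hn
  set e := residual θ a z y w with he
  set G := filterGrad θ a z e w with hG
  have ha1 : ∀ r, |a r| = 1 := fun r => by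
    rw [← sq_eq_sq₀ (abs_nonneg _) zero_le_one, sq_abs, ha, one_pow]
  have hGle := norm_filterGrad_le hθ ha hz e w
  have hd : ∀ r, w' r - w r = -(η • G r) := fun r => by rw [hstep]; abel
  have hdn : ∀ r, ‖w' r - w r‖ ≤ η * (θ * (√n * ‖e‖)) := fun r => by
    rw [hd, norm_neg, norm_smul, Real.norm_of_nonneg hη.le]
    gcongr
    exact hGle r
  -- `p` is the current empirical kernel applied to `e`: the linearized step sends `e` to `e - η •
  -- p`, and `⟪e, p⟫` is the squared norm of the gradient.
  let p : EuclideanSpace ℝ (Fin n) :=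
    WithLp.toLp 2 fun i => ∑ r, θ * a r * ⟪feat (z i) (w r), G r⟫
  have hpe : ⟪e, p⟫ = ∑ r, ‖G r‖ ^ 2 := by
    rw [PiLp.inner_apply]
    simp only [p, RCLike.inner_apply, conj_trivial]
    simp only [Finset.sum_mul]
    rw [Finset.sum_comm]
    refine Finset.sum_congr rfl fun r _ => ?_
    rw [← real_inner_self_eq_norm_sq]
    have hGr : G r = (θ * a r) • ∑ i, e i • feat (z i) (w r) := rfl
    conv_rhs => arg 2; rw [hGr]
    rw [real_inner_smul_left, sum_inner, Finset.mul_sum]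
    refine Finset.sum_congr rfl fun i _ => ?_
    rw [real_inner_smul_left]; ring
  have hpn : ‖p‖ ≤ n * ‖e‖ := by
    have hpi : ∀ i, |p i| ≤ √n * ‖e‖ := fun i => by
      calc |p i| ≤ ∑ r : Fin M, θ * (θ * (√n * ‖e‖)) := by
            change |∑ r, θ * a r * ⟪feat (z i) (w r), G r⟫| ≤ _
            refine (Finset.abs_sum_le_sum_abs (fun r => θ * a r * ⟪feat (z i) (w r), G r⟫) _).trans
              (Finset.sum_le_sum fun r _ => ?_)
            rw [abs_mul, abs_mul, ha1, mul_one, abs_of_nonneg hθ]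
            gcongr
            calc _ ≤ ‖feat (z i) (w r)‖ * ‖G r‖ := abs_real_inner_le_norm _ _
              _ ≤ 1 * (θ * (√n * ‖e‖)) := by
                gcongr
                · exact norm_feat_le_one (hz i) _
                · exact hGle r
              _ = _ := one_mul _
        _ = θ ^ 2 * M * (√n * ‖e‖) := by simp; ring
        _ ≤ 1 * (√n * ‖e‖) := by gcongr
        _ = _ := one_mul _
    refine le_of_sq_le_sq ?_ (by positivity)
    rw [EuclideanSpace.real_norm_sq_eq]
    calc ∑ i, p i ^ 2 ≤ ∑ i : Fin n, (√n * ‖e‖) ^ 2 := by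
          refine Finset.sum_le_sum fun i _ => ?_
          rw [← sq_abs]
          gcongr
          exact hpi i
      _ = (n * ‖e‖) ^ 2 := by simp [mul_pow]; ring
  -- In the expanded square the cross term contributes at most -ηλ‖e‖², and the step size makes the
  -- quadratic term at most ηλ/8 · ‖e‖². Finally 1 - 7ηλ/8 ≤ (1 - 7ηλ/16)².
  have hlin : ‖e - η • p‖ ≤ (1 - 7 / 16 * (η * lam)) * ‖e‖ := by
    have h1 := h.sum_sq_filterGrad_ge hn hlam ha hz hw e
    rw [← hG, ← hpe] at h1
    have h2 : η * n ^ 2 ≤ 1 / 8 * lam := by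
      rw [le_div_iff₀ (by positivity)] at hη1; exact hη1
    have h3 : η ≤ 1 := by nlinarith [one_le_pow₀ (n := 2) hn']
    have h4 : 0 ≤ 1 - 7 / 16 * (η * lam) := by nlinarith
    refine le_of_sq_le_sq ?_ (by positivity)
    rw [norm_sub_sq_real, real_inner_smul_right, norm_smul, Real.norm_of_nonneg hη.le]
    have h5 : (η * ‖p‖) ^ 2 ≤ (η * (n * ‖e‖)) ^ 2 := by gcongr
    have h6 : (η * (n * ‖e‖)) ^ 2 ≤ η * (1 / 8 * lam) * ‖e‖ ^ 2 := by
      calc _ = η * (η * n ^ 2) * ‖e‖ ^ 2 := by ring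
        _ ≤ _ := by gcongr
    have h7 : η * (lam / 2 * ‖e‖ ^ 2) ≤ η * ⟪e, p⟫ := by gcongr
    nlinarith [mul_nonneg (sq_nonneg (η * lam)) (sq_nonneg ‖e‖)]
  -- The linearization error is instability times displacement, which `unst` makes at most ηλ/8 ·
  -- ‖e‖; the contraction survives because 7/16 - 1/8 ≥ 1/4.
  have herr : ‖residual θ a z y w' - (e - η • p)‖ ≤ η * lam / 8 * ‖e‖ := by
    have hi : ∀ i, |(residual θ a z y w' - (e - η • p)) i| ≤ η * lam / (8 * n) * (√n * ‖e‖) := by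
      intro i
      have : (residual θ a z y w' - (e - η • p)) i = ∑ r, θ * a r * (pool (z i) (w' r) -
          pool (z i) (w r) - ⟪feat (z i) (w r), w' r - w r⟫) := by
        simp only [he, residual, PiLp.sub_apply, PiLp.smul_apply, p, hd, inner_neg_right,
          real_inner_smul_right, smul_eq_mul, mul_sub, Finset.sum_sub_distrib, Finset.mul_sum,
          mul_neg, Finset.sum_neg_distrib]
        have : ∀ r, θ * a r * (η * ⟪feat (z i) (w r), G r⟫) =
          η * (θ * a r * ⟪feat (z i) (w r), G r⟫) := fun r => by ring
        simp only [this, mul_assoc]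
        ring
      rw [this]
      calc _ ≤ ∑ r, θ * (unstable R (z i) (w₀ r) * (η * (θ * (√n * ‖e‖)))) := by
            refine (Finset.abs_sum_le_sum_abs _ _).trans (Finset.sum_le_sum fun r _ => ?_)
            rw [abs_mul, abs_mul, ha1, mul_one, abs_of_nonneg hθ]
            gcongr
            refine (abs_pool_sub_le (hz i) (hw r) (hw' r)).trans ?_
            gcongr
            · exact unstable_nonneg _ _ _
            · exact hdn r
        _ = η * (√n * ‖e‖) * (θ ^ 2 * ∑ r, unstable R (z i) (w₀ r)) := by
            rw [Finset.mul_sum, Finset.mul_sum]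
            exact Finset.sum_congr rfl fun r _ => by ring
        _ ≤ η * (√n * ‖e‖) * (lam / (8 * n)) := by
            gcongr
            exact h.unst i
        _ = _ := by ring
    refine le_of_sq_le_sq ?_ (by positivity)
    rw [EuclideanSpace.real_norm_sq_eq]
    calc _ ≤ ∑ i : Fin n, (η * lam / (8 * n) * (√n * ‖e‖)) ^ 2 := by
          refine Finset.sum_le_sum fun i _ => ?_
          rw [← sq_abs]
          gcongr
          exact hi i
      _ = _ := by
        simp [mul_pow]
        field_simp
  calc ‖residual θ a z y w'‖ = ‖(e - η • p) + (residual θ a z y w' - (e - η • p))‖ := by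
        congr 1; abel
    _ ≤ (1 - 7 / 16 * (η * lam)) * ‖e‖ + η * lam / 8 * ‖e‖ :=
        (norm_add_le _ _).trans (add_le_add hlin herr)
    _ ≤ _ := by nlinarith [mul_nonneg (mul_nonneg hη.le hlam.le) (norm_nonneg e)]

/-- Gradient descent from well spread filters never moves a filter by more than `R`, provided that
the initial errors are small compared to `R / θ`. -/
lemma WellSpread.norm_gradDescent_sub_le {θ lam R η : ℝ} (hn : 0 < n) (hθ : 0 ≤ θ)
    (hθM : θ ^ 2 * M ≤ 1) (hlam : 0 < lam) (hlam1 : lam ≤ 1) (hη : 0 < η)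
    (hη1 : η ≤ 1 / 8 * lam / n ^ 2)
    {a : Fin M → ℝ} (ha : ∀ r, a r ^ 2 = 1) {z : Fin n → J → V} (hz : ∀ i j, ‖z i j‖ = 1)
    (y : Fin n → ℝ) {w : ℕ → Fin M → V} (h : WellSpread θ lam R z (w 0))
    (hres : 4 * √n * θ * ‖residual θ a z y (w 0)‖ ≤ lam * R)
    (hstep : ∀ t r, w (t + 1) r = w t r - η • filterGrad θ a z (residual θ a z y (w t)) (w t) r)
    (t : ℕ) (r : Fin M) : ‖w t r - w 0 r‖ ≤ R := by
  have hn' : (1 : ℝ) ≤ n := by exact_mod_cast hn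
  set S := ‖residual θ a z y (w 0)‖
  set ρ := 1 - η * lam / 4 with hρ
  have hρ0 : 0 ≤ ρ := by
    have h2 : η * n ^ 2 ≤ 1 / 8 * lam := by
      rw [le_div_iff₀ (by positivity)] at hη1; exact hη1
    have h3 : η ≤ 1 := by nlinarith [one_le_pow₀ (n := 2) hn']
    nlinarith
  have hS : 4 * √n * θ * S / lam ≤ R := by rw [div_le_iff₀ hlam]; linarith
  have hbound : ∀ t, 4 * √n * θ * S / lam * (1 - ρ ^ t) ≤ R := fun t => by
    refine (mul_le_of_le_one_right (by positivity) ?_).trans hS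
    linarith [pow_nonneg hρ0 t]
  -- The displacement bound is the partial sum of the geometric series of step lengths η θ √n ρ^t S,
  -- with 1 - ρ = ηλ/4.
  suffices H : ∀ t, ‖residual θ a z y (w t)‖ ≤ ρ ^ t * S ∧
      ∀ r, ‖w t r - w 0 r‖ ≤ 4 * √n * θ * S / lam * (1 - ρ ^ t) from ((H t).2 r).trans (hbound t)
  intro t
  induction t with
  | zero => simp [S]
  | succ t ih =>
    obtain ⟨ih1, ih2⟩ := ih
    -- The displacement at time t + 1 needs only the residual at time t. It has to come first, since
    -- the contraction assumes that the new filters are still within R.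
    have key : ∀ r, ‖w (t + 1) r - w 0 r‖ ≤ 4 * √n * θ * S / lam * (1 - ρ ^ (t + 1)) := by
      intro r
      calc ‖w (t + 1) r - w 0 r‖ = ‖(w t r - w 0 r) -
            η • filterGrad θ a z (residual θ a z y (w t)) (w t) r‖ := by
            rw [hstep]; congr 1; abel
        _ ≤ 4 * √n * θ * S / lam * (1 - ρ ^ t) + η * (θ * (√n * (ρ ^ t * S))) := by
            refine (norm_sub_le _ _).trans (add_le_add (ih2 r) ?_)
            rw [norm_smul, Real.norm_of_nonneg hη.le]
            gcongr
            refine (norm_filterGrad_le hθ ha hz _ _ _).trans ?_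
            gcongr
        _ = _ := by
            rw [pow_succ, hρ]
            field_simp
            ring
    refine ⟨?_, key⟩
    calc _ ≤ ρ * ‖residual θ a z y (w t)‖ :=
          h.norm_residual_step_le hn hθ hθM hlam hlam1 hη hη1 ha hz y
            (fun r => (ih2 r).trans (hbound t)) (fun r => (key r).trans (hbound (t + 1))) (hstep t)
      _ ≤ ρ * (ρ ^ t * S) := by gcongr
      _ = _ := by ring

end Deterministic

/-! ### Measurability of the responses -/

section Measurability

lemma measurable_reluDeriv : Measurable reluDeriv :=
  Measurable.ite measurableSet_Ici measurable_const measurable_const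

lemma measurable_relu : Measurable relu := measurable_id.max measurable_const

variable {V : Type*} [NormedAddCommGroup V] [InnerProductSpace ℝ V] [FiniteDimensional ℝ V]
  [MeasurableSpace V] [BorelSpace V] {J : Type*} [Fintype J]

lemma measurable_pool (z : J → V) : Measurable (pool z) := by
  refine (Finset.measurable_sum _ fun j _ => measurable_relu.comp ?_).const_mul _
  fun_prop

lemma measurable_feat (z : J → V) : Measurable (feat z) := by
  refine (Finset.measurable_sum _ fun j _ => ?_).const_smul _
  refine Measurable.smul_const (measurable_reluDeriv.comp ?_) _
  fun_prop

lemma measurable_unstable (R : ℝ) (z : J → V) : Measurable (unstable R z) := by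
  refine (Finset.measurable_sum _ fun j _ => ?_).const_mul _
  refine Measurable.ite (measurableSet_le ?_ measurable_const) measurable_const measurable_const
  fun_prop

end Measurability

/-! ### Second moment deviation bounds on product spaces -/

section Chebyshev

variable {ι E : Type*} [Fintype ι] [MeasurableSpace E] {μ : Measure E} [IsProbabilityMeasure μ]

/-- **Chebyshev's inequality** for a weighted sum of independent identically distributed
variables. -/
lemma pi_real_abs_sum_sub_ge_le {φ : E → ℝ} (hφ : MemLp φ 2 μ) (b : ι → ℝ) {t : ℝ} (ht : 0 < t) :
    (Measure.pi fun _ : ι => μ).real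
      {v | t ≤ |∑ i, b i * φ (v i) - (∑ i, b i) * ∫ x, φ x ∂μ|} ≤
      (∑ i, b i ^ 2) * Var[φ; μ] / t ^ 2 := by
  have hcomp : ∀ i, MemLp (fun v : ι → E => b i * φ (v i)) 2 (Measure.pi fun _ : ι => μ) :=
    fun i => (hφ.comp_measurePreserving (measurePreserving_eval (fun _ : ι => μ) i)).const_mul _
  have hmem : MemLp (fun v : ι → E => ∑ i, b i * φ (v i)) 2 (Measure.pi fun _ : ι => μ) :=
    memLp_finsetSum _ fun i _ => hcomp i
  have hmean : ∫ v, ∑ i, b i * φ (v i) ∂(Measure.pi fun _ : ι => μ) =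
      (∑ i, b i) * ∫ x, φ x ∂μ := by
    rw [integral_finsetSum _ fun i _ => (hcomp i).integrable one_le_two, Finset.sum_mul]
    refine Finset.sum_congr rfl fun i _ => ?_
    rw [integral_const_mul, integral_comp_eval (μ := fun _ : ι => μ) hφ.1]
  have hvar : Var[fun v : ι → E => ∑ i, b i * φ (v i); Measure.pi fun _ : ι => μ] =
      (∑ i, b i ^ 2) * Var[φ; μ] := by
    have h := variance_sum_pi (μ := fun _ : ι => μ) (X := fun i x => b i * φ x)
      fun i => hφ.const_mul _
    have e : (∑ i, fun ω : ι → E => b i * φ (ω i)) = fun v => ∑ i, b i * φ (v i) := by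
      ext; simp
    rw [e] at h
    rw [h, Finset.sum_mul]
    exact Finset.sum_congr rfl fun i _ => variance_const_mul _ _ _
  have h := meas_ge_le_variance_div_sq hmem ht
  rw [hmean, hvar] at h
  refine ENNReal.toReal_le_of_le_ofReal ?_ h
  have := variance_nonneg φ μ
  positivity

lemma memLp_of_abs_le_one {φ : E → ℝ} (hm : Measurable φ) (h : ∀ x, |φ x| ≤ 1) :
    MemLp φ 2 μ :=
  MemLp.of_bound hm.aestronglyMeasurable 1 (.of_forall h)

lemma variance_le_one_of_abs_le_one {φ : E → ℝ} (hm : Measurable φ) (h : ∀ x, |φ x| ≤ 1) :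
    Var[φ; μ] ≤ 1 := by
  have := variance_le_sq_of_bounded (μ := μ) (X := φ) (a := -1) (b := 1)
    (.of_forall fun x => abs_le.mp (h x)) hm.aemeasurable
  norm_num at this
  exact this

/-- A deviation bound for sums of bounded independent identically distributed variables. -/
lemma pi_real_abs_sum_sub_ge_le_of_abs_le_one {M : ℕ} {φ : E → ℝ} (hm : Measurable φ)
    (h : ∀ x, |φ x| ≤ 1) {θ : ℝ} (hθM : θ ^ 2 * M ≤ 1) {t : ℝ} (ht : 0 < t) :
    (Measure.pi fun _ : Fin M => μ).real
      {v | t ≤ |θ ^ 2 * ∑ r, φ (v r) - θ ^ 2 * M * ∫ x, φ x ∂μ|} ≤ θ ^ 2 / t ^ 2 := by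
  have h1 := pi_real_abs_sum_sub_ge_le (memLp_of_abs_le_one hm h : MemLp φ 2 μ)
    (fun _ : Fin M => θ ^ 2) ht
  simp only [← Finset.mul_sum, Finset.sum_const, Finset.card_univ, Fintype.card_fin,
    nsmul_eq_mul] at h1
  rw [mul_comm (M : ℝ) (θ ^ 2)] at h1
  refine h1.trans ?_
  gcongr
  calc (M : ℝ) * (θ ^ 2) ^ 2 * Var[φ; μ] ≤ M * (θ ^ 2) ^ 2 * 1 := by
        gcongr
        exact variance_le_one_of_abs_le_one hm h
    _ = θ ^ 2 * M * θ ^ 2 := by ring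
    _ ≤ 1 * θ ^ 2 := by gcongr
    _ = _ := one_mul _

end Chebyshev

/-! ### Gaussian estimates for a single filter -/

section Gaussian

variable {V : Type*} [NormedAddCommGroup V] [InnerProductSpace ℝ V] [FiniteDimensional ℝ V]
  [MeasurableSpace V] [BorelSpace V] {J : Type*} [Fintype J]

lemma stdGaussian_map_inner {z : V} (hz : ‖z‖ = 1) :
    (stdGaussian V).map (fun w => ⟪w, z⟫) = gaussianReal 0 1 := by
  have h := IsGaussian.map_eq_gaussianReal (μ := stdGaussian V) (innerSL ℝ z)
  rw [integral_strongDual_stdGaussian, variance_dual_stdGaussian, innerSL_apply_norm, hz] at h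
  simp only [one_pow, Real.toNNReal_one] at h
  rw [← h]
  congr 1
  ext w
  simp [real_inner_comm]

/-- The density is at most 1/√(2π) ≤ 1/2, on an interval of length 2R. -/
lemma gaussianReal_real_abs_le {R : ℝ} (hR : 0 ≤ R) :
    (gaussianReal 0 1).real {x | |x| ≤ R} ≤ R := by
  refine ENNReal.toReal_le_of_le_ofReal hR ?_
  have hs : {x : ℝ | |x| ≤ R} = Set.Icc (-R) R := by ext; simp [abs_le]
  rw [gaussianReal_apply 0 one_ne_zero, hs]
  have hpdf : ∀ x, gaussianPDF 0 1 x ≤ ENNReal.ofReal (1 / 2) := fun x => by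
    rw [gaussianPDF]
    refine ENNReal.ofReal_le_ofReal ?_
    unfold gaussianPDFReal
    have h2 : (2 : ℝ) ≤ √(2 * Real.pi * (1 : NNReal)) := by
      refine Real.le_sqrt_of_sq_le ?_
      have := Real.pi_gt_three
      push_cast
      linarith
    calc _ ≤ (√(2 * Real.pi * (1 : NNReal)))⁻¹ * 1 := by
          gcongr
          refine Real.exp_le_one_iff.mpr ?_
          have := sq_nonneg (x - 0)
          push_cast
          linarith
      _ ≤ _ := by
          rw [mul_one, one_div]
          gcongr
  calc _ ≤ ∫⁻ _ in Set.Icc (-R) R, ENNReal.ofReal (1 / 2) := lintegral_mono fun x => hpdf x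
    _ = ENNReal.ofReal R := by
      rw [setLIntegral_const, Real.volume_Icc, ← ENNReal.ofReal_mul (by norm_num)]
      congr 1
      ring

lemma integral_unstable_le {z : J → V} (hz : ∀ j, ‖z j‖ = 1) {R : ℝ} (hR : 0 ≤ R) :
    ∫ w, unstable R z w ∂(stdGaussian V) ≤ R := by
  have hset : ∀ j, MeasurableSet {w : V | |⟪w, z j⟫| ≤ R} := fun j =>
    measurableSet_le (by fun_prop) measurable_const
  have e : ∀ w j, (if |⟪w, z j⟫| ≤ R then (1 : ℝ) else 0) =
      {w : V | |⟪w, z j⟫| ≤ R}.indicator 1 w := fun w j => by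
    simp [Set.indicator_apply]
  unfold unstable
  simp_rw [e]
  rw [integral_const_mul, integral_finsetSum]
  · have hj : ∀ j, ∫ w, {w : V | |⟪w, z j⟫| ≤ R}.indicator (1 : V → ℝ) w ∂(stdGaussian V) ≤ R := by
      intro j
      rw [integral_indicator_one (hset j)]
      have h := gaussianReal_real_abs_le hR
      rwa [← stdGaussian_map_inner (hz j), map_measureReal_apply (by fun_prop)
        (measurableSet_le (by fun_prop) measurable_const)] at h
    calc _ ≤ (Fintype.card J : ℝ)⁻¹ * ∑ _j : J, R := by
          gcongr with j
          exact hj j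
      _ = (Fintype.card J : ℝ)⁻¹ * (Fintype.card J) * R := by simp [mul_assoc]
      _ ≤ 1 * R := by
          gcongr
          exact inv_mul_le_one
      _ = R := one_mul R
  · exact fun j _ => (integrable_const (1 : ℝ)).indicator (hset j)

lemma memLp_inner_stdGaussian (z : V) : MemLp (fun w => ⟪w, z⟫) 2 (stdGaussian V) :=
  IsGaussian.memLp_two_id.inner_const z

lemma integral_inner_sq_stdGaussian {z : V} (hz : ‖z‖ = 1) :
    ∫ w, ⟪w, z⟫ ^ 2 ∂(stdGaussian V) = 1 := by
  have h : ∫ x, x ^ 2 ∂((stdGaussian V).map (fun w => ⟪w, z⟫)) = 1 := by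
    rw [stdGaussian_map_inner hz]
    have := variance_fun_id_gaussianReal (μ := 0) (v := 1)
    rw [variance_eq_integral (by fun_prop)] at this
    simpa using this
  rwa [integral_map (by fun_prop) (by fun_prop)] at h

/-- By Jensen over the positions, since every preactivation is a standard Gaussian variable. It
keeps the initial output bounded in mean square, uniformly in the width. -/
lemma lintegral_pool_sq_le {z : J → V} (hz : ∀ j, ‖z j‖ = 1) :
    ∫⁻ w, ENNReal.ofReal (pool z w ^ 2) ∂(stdGaussian V) ≤ 1 := by
  calc _ ≤ ∫⁻ w, ENNReal.ofReal ((Fintype.card J : ℝ)⁻¹ * ∑ j, ⟪w, z j⟫ ^ 2) ∂(stdGaussian V) :=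
        lintegral_mono fun w => ENNReal.ofReal_le_ofReal (pool_sq_le z w)
    _ = ENNReal.ofReal (∫ w, (Fintype.card J : ℝ)⁻¹ * ∑ j, ⟪w, z j⟫ ^ 2 ∂(stdGaussian V)) := by
        rw [ofReal_integral_eq_lintegral_ofReal]
        · exact (integrable_finsetSum _ fun j _ =>
            (memLp_inner_stdGaussian (z j)).integrable_sq).const_mul _
        · exact .of_forall fun w => by positivity
    _ ≤ 1 := by
        rw [integral_const_mul, integral_finsetSum _ fun j _ =>
            (memLp_inner_stdGaussian (z j)).integrable_sq]
        simp only [integral_inner_sq_stdGaussian (hz _)]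
        exact ENNReal.ofReal_le_one.mpr (inv_card_mul_sum_le_one fun j => le_rfl)

end Gaussian

/-! ### The random initialization -/

section InitialLaw

/-- The filter `r` of a convolution tensor. -/
def filter {m c s : ℕ} (W : ConvTensor m c s) (r : Fin m) : Patch c s :=
  WithLp.toLp 2 fun kl => W (r, kl)

lemma measurable_filter {m c s : ℕ} : Measurable (filter : ConvTensor m c s → Fin m → Patch c s) := by
  refine measurable_pi_lambda _ fun r => (WithLp.measurable_toLp 2 _).comp ?_
  fun_prop

/-- By characteristic functions: the squared norm in the Gaussian exponent is a sum over the
filters. -/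
lemma stdGaussian_map_filter (m c s : ℕ) :
    (stdGaussian (ConvTensor m c s)).map filter =
      Measure.pi fun _ : Fin m => stdGaussian (Patch c s) := by
  have : IsFiniteMeasure ((stdGaussian (ConvTensor m c s)).map
      (filter : ConvTensor m c s → Fin m → Patch c s)) := by infer_instance
  refine charFun_eq_pi_iff.mp fun t => ?_
  have e : ∀ W : ConvTensor m c s, ⟪WithLp.toLp 2 (filter W), t⟫ =
      ⟪W, (WithLp.toLp 2 fun rkl => t rkl.1 rkl.2 : ConvTensor m c s)⟫ := fun W => by
    simp [PiLp.inner_apply, filter, Fintype.sum_prod_type]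
  rw [Measure.map_map (WithLp.measurable_toLp 2 _) measurable_filter, charFun_apply,
    integral_map ((WithLp.measurable_toLp 2 _).comp measurable_filter).aemeasurable
      (by fun_prop)]
  simp only [Function.comp_apply, e]
  rw [← charFun_apply, charFun_stdGaussian]
  simp only [charFun_stdGaussian, ← Complex.exp_sum]
  congr 1
  rw [← Finset.sum_div, Finset.sum_neg_distrib]
  congr 2
  norm_cast
  simp [EuclideanSpace.real_norm_sq_eq, Fintype.sum_prod_type]

lemma norm_sq_eq_sum_filter {m c s : ℕ} (W : ConvTensor m c s) :
    ‖W‖ ^ 2 = ∑ r, ‖filter W r‖ ^ 2 := by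
  simp [EuclideanSpace.real_norm_sq_eq, filter, Fintype.sum_prod_type]

/-- The law of one uniform sign. -/
abbrev signLaw : Measure ℝ := uniformOn ({-1, 1} : Set ℝ)

instance : IsProbabilityMeasure signLaw :=
  isProbabilityMeasure_uniformOn (by simp) (by simp)

instance (m c s : ℕ) : IsProbabilityMeasure (initLaw m c s) := by
  unfold initLaw
  infer_instance

lemma ae_signLaw_sq : ∀ᵐ x ∂signLaw, x ^ 2 = 1 := by
  have h : ∀ᵐ x ∂signLaw, x ∈ ({-1, 1} : Set ℝ) := ae_cond_mem (by measurability)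
  filter_upwards [h] with x hx
  rcases hx with rfl | rfl <;> norm_num

lemma signLaw_singleton_neg : signLaw {-1} = signLaw {1} := by
  have h1 := uniformOn_apply_finset (Ω := ℝ) (s := {-1, 1}) (t := {-1})
  have h2 := uniformOn_apply_finset (Ω := ℝ) (s := {-1, 1}) (t := {1})
  push_cast at h1 h2
  rw [signLaw, h1, h2, Finset.inter_eq_right.mpr (by simp), Finset.inter_eq_right.mpr (by simp)]
  simp

lemma integral_signLaw : ∫ x, x ∂signLaw = 0 := by
  have hr : signLaw = signLaw.restrict ({-1, 1} : Finset ℝ) := by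
    rw [Measure.restrict_eq_self_of_ae_mem]
    have h : ∀ᵐ x ∂signLaw, x ∈ ({-1, 1} : Set ℝ) := ae_cond_mem (by measurability)
    simpa using h
  rw [hr, setIntegral_finset]
  · rw [Finset.sum_pair (by norm_num)]
    simp [Measure.real, signLaw_singleton_neg]
  · exact IntegrableOn.finset

lemma memLp_id_signLaw : MemLp (fun x : ℝ => x) 2 signLaw := by
  refine MemLp.of_bound (by fun_prop) 1 ?_
  filter_upwards [ae_signLaw_sq] with x hx
  rw [Real.norm_eq_abs, ← sq_le_sq₀ (abs_nonneg _) zero_le_one, sq_abs, hx, one_pow]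

lemma variance_signLaw_le : Var[fun x : ℝ => x; signLaw] ≤ 1 := by
  refine (variance_le_expectation_sq (by fun_prop)).trans ?_
  simp only [Pi.pow_apply]
  rw [integral_congr_ae ae_signLaw_sq]
  simp

lemma initLaw_real_preimage_filter {m c s : ℕ} {A : Set (Fin m → Patch c s)}
    (hA : MeasurableSet A) :
    (initLaw m c s).real {aW | filter aW.2 ∈ A} =
      (Measure.pi fun _ : Fin m => stdGaussian (Patch c s)).real A := by
  have h : MeasurePreserving (fun aW : (Fin m → ℝ) × ConvTensor m c s => filter aW.2)
      (initLaw m c s) (Measure.pi fun _ : Fin m => stdGaussian (Patch c s)) :=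
    MeasurePreserving.comp ⟨measurable_filter, stdGaussian_map_filter m c s⟩
      measurePreserving_snd
  exact h.measureReal_preimage hA.nullMeasurableSet

lemma ae_initLaw_sign_sq (m c s : ℕ) : ∀ᵐ aW ∂(initLaw m c s), ∀ r, aW.1 r ^ 2 = 1 := by
  refine ae_all_iff.mpr fun r => ?_
  have h : MeasurePreserving (fun aW : (Fin m → ℝ) × ConvTensor m c s => aW.1 r)
      (initLaw m c s) signLaw :=
    (measurePreserving_eval (fun _ : Fin m => signLaw) r).comp measurePreserving_fst
  exact h.quasiMeasurePreserving.ae ae_signLaw_sq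

/-- The initial prediction is bounded with high probability. -/
lemma initLaw_real_abs_net_ge_le {m c s : ℕ} {J : Type*} [Fintype J] {z : J → Patch c s}
    (hz : ∀ j, ‖z j‖ = 1) {θ : ℝ} (hθM : θ ^ 2 * m ≤ 1) {t : ℝ} (ht : 0 < t) :
    (initLaw m c s).real {aW | t ≤ |θ * ∑ r, aW.1 r * pool z (filter aW.2 r)|} ≤ 1 / t ^ 2 := by
  have hmeas : MeasurableSet {aW : (Fin m → ℝ) × ConvTensor m c s |
      t ≤ |θ * ∑ r, aW.1 r * pool z (filter aW.2 r)|} := by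
    refine measurableSet_le measurable_const (Measurable.abs ?_)
    refine (Finset.measurable_sum _ fun r _ => ?_).const_mul _
    refine Measurable.mul (by fun_prop) ((measurable_pool z).comp ?_)
    exact (measurable_pi_apply r).comp (measurable_filter.comp measurable_snd)
  refine ENNReal.toReal_le_of_le_ofReal (by positivity) ?_
  unfold initLaw
  rw [Measure.prod_apply_symm hmeas]
  -- For fixed filters the signs are independent and centred, so Chebyshev applies with the weights
  -- θ · `pool`; the bound is then averaged over the filters by Fubini.
  have hW : ∀ W : ConvTensor m c s, (Measure.pi fun _ : Fin m => signLaw)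
      {a | t ≤ |θ * ∑ r, a r * pool z (filter W r)|} ≤
      ENNReal.ofReal (θ ^ 2 / t ^ 2) * ∑ r, ENNReal.ofReal (pool z (filter W r) ^ 2) := by
    intro W
    have h := pi_real_abs_sum_sub_ge_le memLp_id_signLaw (fun r => θ * pool z (filter W r)) ht
    have e : ∀ a : Fin m → ℝ, ∑ r, θ * pool z (filter W r) * a r =
        θ * ∑ r, a r * pool z (filter W r) := fun a => by
      rw [Finset.mul_sum]
      exact Finset.sum_congr rfl fun r _ => by ring
    simp only [integral_signLaw, mul_zero, sub_zero, e] at h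
    rw [← ENNReal.ofReal_sum_of_nonneg fun r _ => sq_nonneg _,
      ← ENNReal.ofReal_mul (by positivity), ← ofReal_measureReal]
    refine ENNReal.ofReal_le_ofReal (h.trans ?_)
    calc _ ≤ (∑ r, (θ * pool z (filter W r)) ^ 2) * 1 / t ^ 2 := by
          gcongr
          exact variance_signLaw_le
      _ = _ := by
          simp only [mul_pow, ← Finset.mul_sum]
          ring
  have hfil : ∀ r, MeasurePreserving (fun W : ConvTensor m c s => filter W r)
      (stdGaussian (ConvTensor m c s)) (stdGaussian (Patch c s)) := fun r =>
    (measurePreserving_eval (fun _ : Fin m => stdGaussian (Patch c s)) r).comp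
      ⟨measurable_filter, stdGaussian_map_filter m c s⟩
  have hp : Measurable fun w : Patch c s => ENNReal.ofReal (pool z w ^ 2) :=
    ((measurable_pool z).pow_const 2).ennreal_ofReal
  have hpc : ∀ r, Measurable fun W : ConvTensor m c s =>
      ENNReal.ofReal (pool z (filter W r) ^ 2) := fun r => hp.comp (hfil r).measurable
  calc _ ≤ ∫⁻ W, ENNReal.ofReal (θ ^ 2 / t ^ 2) * ∑ r, ENNReal.ofReal (pool z (filter W r) ^ 2)
        ∂(stdGaussian (ConvTensor m c s)) := lintegral_mono fun W => hW W
    _ = ENNReal.ofReal (θ ^ 2 / t ^ 2) * ∑ r, ∫⁻ W, ENNReal.ofReal (pool z (filter W r) ^ 2)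
        ∂(stdGaussian (ConvTensor m c s)) := by
        rw [lintegral_const_mul' _ _ ENNReal.ofReal_ne_top,
          lintegral_finsetSum _ fun r _ => hpc r]
    _ ≤ ENNReal.ofReal (θ ^ 2 / t ^ 2) * ∑ _r : Fin m, 1 := by
        gcongr with r
        rw [(hfil r).lintegral_comp hp]
        exact lintegral_pool_sq_le hz
    _ = ENNReal.ofReal (θ ^ 2 / t ^ 2) * ENNReal.ofReal m := by simp
    _ = ENNReal.ofReal (θ ^ 2 * m / t ^ 2) := by
        rw [← ENNReal.ofReal_mul (by positivity)]
        congr 1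
        ring
    _ ≤ _ := ENNReal.ofReal_le_ofReal (by gcongr)

/-- The variance of the square of a standard Gaussian variable. -/
def gaussianSqVar : ℝ := Var[fun x : ℝ => x ^ 2; gaussianReal 0 1]

lemma memLp_sq_gaussianReal : MemLp (fun x : ℝ => x ^ 2) 2 (gaussianReal 0 1) := by
  have h : MemLp (fun x : ℝ => x) 4 (gaussianReal 0 1) := memLp_id_gaussianReal 4
  refine (memLp_two_iff_integrable_sq (by fun_prop)).mpr ?_
  refine (h.integrable_norm_pow (p := 4) (by norm_num)).congr (.of_forall fun x => ?_)
  simp only [Real.norm_eq_abs, ← pow_mul]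
  exact Even.pow_abs (by decide) x

/-- The squared norm of the initial tensor concentrates around the number of its entries. -/
lemma initLaw_real_abs_norm_sq_ge_le {m c s : ℕ} {t : ℝ} (ht : 0 < t) :
    (initLaw m c s).real {aW | t ≤ |‖aW.2‖ ^ 2 - m * (c * (2 * s + 1))|} ≤
      m * (c * (2 * s + 1)) * gaussianSqVar / t ^ 2 := by
  have h := pi_real_abs_sum_sub_ge_le (ι := Fin m × Fin c × Fin (2 * s + 1))
    memLp_sq_gaussianReal (fun _ => 1) ht
  have hint : ∫ x : ℝ, x ^ 2 ∂(gaussianReal 0 1) = 1 := by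
    have := variance_fun_id_gaussianReal (μ := 0) (v := 1)
    rw [variance_eq_integral (by fun_prop)] at this
    simpa using this
  simp only [one_mul, one_pow, hint, mul_one, Finset.sum_const, Finset.card_univ,
    Fintype.card_prod, Fintype.card_fin, nsmul_eq_mul] at h
  push_cast at h
  rw [← gaussianSqVar] at h
  refine le_trans (le_of_eq ?_) h
  have hpres : MeasurePreserving (fun aW : (Fin m → ℝ) × ConvTensor m c s => WithLp.ofLp aW.2)
      (initLaw m c s) (Measure.pi fun _ => gaussianReal 0 1) := by
    refine MeasurePreserving.comp ⟨WithLp.measurable_ofLp 2 _, ?_⟩ measurePreserving_snd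
    rw [← map_pi_eq_stdGaussian,
      Measure.map_map (WithLp.measurable_ofLp 2 _) (WithLp.measurable_toLp 2 _)]
    exact Measure.map_id
  rw [← hpres.measureReal_preimage (measurableSet_le measurable_const
    (by fun_prop)).nullMeasurableSet]
  congr 1
  ext aW
  simp [EuclideanSpace.real_norm_sq_eq]

end InitialLaw

/-! ### Translation between convolution tensors and families of filters -/

section Bridge

variable {m c s D n : ℕ}

lemma conv_eq_inner (W : ConvTensor m c s) (x : Input c D) (r : Fin m) (j : ZMod D) :
    conv W x r j = ⟪filter W r, patch s x j⟫ := by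
  simp [conv, filter, patch, PiLp.inner_apply, Fintype.sum_prod_type, mul_comm]

variable [NeZero D]

lemma net_eq (N : ℕ) (a : Fin m → ℝ) (W : ConvTensor m c s) (x : Input c D) :
    net N a W x = 1 / √(N : ℝ) * ∑ r, a r * pool (patch s x) (filter W r) := by
  simp only [net, avgPool, pool, conv_eq_inner, ZMod.card, ← Finset.mul_sum]
  rw [Finset.mul_sum]
  refine Finset.sum_congr rfl fun r _ => ?_
  rw [one_div (D : ℝ)]
  ring

lemma residual_eq (N : ℕ) (a : Fin m → ℝ) (x : Fin n → Input c D) (y : Fin n → ℝ)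
    (W : ConvTensor m c s) (i : Fin n) :
    residual (1 / √(N : ℝ)) a (fun i => patch s (x i)) y (filter W) i = net N a W (x i) - y i := by
  rw [net_eq]
  rfl

lemma filter_lossGrad (N : ℕ) (a : Fin m → ℝ) (x : Fin n → Input c D) (y : Fin n → ℝ)
    (W : ConvTensor m c s) (r : Fin m) :
    filter (lossGrad N a x y W) r = filterGrad (1 / √(N : ℝ)) a (fun i => patch s (x i))
      (residual (1 / √(N : ℝ)) a (fun i => patch s (x i)) y (filter W)) (filter W) r := by
  ext kl
  simp only [filter, lossGrad, filterGrad, residual_eq, feat, PiLp.smul_apply, WithLp.ofLp_sum,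
    Finset.sum_apply, smul_eq_mul, ZMod.card, conv_eq_inner, Finset.mul_sum]
  refine Finset.sum_congr rfl fun i _ => Finset.sum_congr rfl fun j _ => ?_
  rw [one_div (D : ℝ)]
  ring

/-- This is the recursion `hstep` of `WellSpread.norm_gradDescent_sub_le`, through which the
deterministic analysis reaches the network. -/
lemma filter_gradDescent_succ (N : ℕ) (a : Fin m → ℝ) (x : Fin n → Input c D) (y : Fin n → ℝ)
    (η : ℝ) (W : ConvTensor m c s) (t : ℕ) (r : Fin m) :
    filter (gradDescent N a x y η W (t + 1)) r = filter (gradDescent N a x y η W t) r -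
      η • filterGrad (1 / √(N : ℝ)) a (fun i => patch s (x i))
        (residual (1 / √(N : ℝ)) a (fun i => patch s (x i)) y
          (filter (gradDescent N a x y η W t))) (filter (gradDescent N a x y η W t)) r := by
  rw [← filter_lossGrad]
  rfl

lemma filter_sub (A B : ConvTensor m c s) (r : Fin m) :
    filter (A - B) r = filter A r - filter B r := rfl

end Bridge

/-! ### The initialization is good with high probability -/

section GoodEvent

/-- The expected inner product of the gradients of two pooled responses at a Gaussian filter. -/
def featGram {V J : Type*} [NormedAddCommGroup V] [InnerProductSpace ℝ V] [FiniteDimensional ℝ V]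
    [MeasurableSpace V] [BorelSpace V] [Fintype J] (z z' : J → V) : ℝ :=
  ∫ w, ⟪feat z w, feat z' w⟫ ∂(stdGaussian V)

lemma abs_inner_feat_le_one {V J : Type*} [NormedAddCommGroup V] [InnerProductSpace ℝ V] [Fintype J]
    {z z' : J → V} (hz : ∀ j, ‖z j‖ = 1) (hz' : ∀ j, ‖z' j‖ = 1) (w : V) :
    |⟪feat z w, feat z' w⟫| ≤ 1 := by
  calc _ ≤ ‖feat z w‖ * ‖feat z' w‖ := abs_real_inner_le_norm _ _
    _ ≤ 1 * 1 := by
      gcongr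
      · exact norm_feat_le_one hz w
      · exact norm_feat_le_one hz' w
    _ = 1 := one_mul 1

lemma norm_sq_sum_smul {V : Type*} [NormedAddCommGroup V] [InnerProductSpace ℝ V] {n : ℕ}
    (e : Fin n → ℝ) (v : Fin n → V) :
    ‖∑ i, e i • v i‖ ^ 2 = ∑ i, ∑ i', e i * e i' * ⟪v i, v i'⟫ := by
  rw [← real_inner_self_eq_norm_sq, sum_inner]
  refine Finset.sum_congr rfl fun i _ => ?_
  rw [inner_sum]
  refine Finset.sum_congr rfl fun i' _ => ?_
  rw [real_inner_smul_left, real_inner_smul_right]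
  ring

/-- If the empirical Gram matrix and the empirical instability are close to their means, then the
filters are well spread. -/
lemma WellSpread.of_deviation {V J : Type*} [NormedAddCommGroup V] [InnerProductSpace ℝ V]
    [FiniteDimensional ℝ V] [MeasurableSpace V] [BorelSpace V] [Fintype J] {n M : ℕ} (hn : 0 < n)
    {z : Fin n → J → V} (hz : ∀ i j, ‖z i j‖ = 1) {θ lam R : ℝ} (hθM : θ ^ 2 * M ≤ 1)
    (hlam : 0 < lam) (hR : 0 ≤ R) (hR1 : R ≤ lam / (16 * n))
    (hquad : ∀ e : EuclideanSpace ℝ (Fin n),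
      lam * ‖e‖ ^ 2 ≤ θ ^ 2 * M * ∑ i, ∑ i', e i * e i' * featGram (z i) (z i'))
    {w : Fin M → V}
    (h1 : ∀ i i', |θ ^ 2 * ∑ r, ⟪feat (z i) (w r), feat (z i') (w r)⟫ -
      θ ^ 2 * M * featGram (z i) (z i')| ≤ lam / (4 * n))
    (h2 : ∀ i, |θ ^ 2 * ∑ r, unstable R (z i) (w r) -
      θ ^ 2 * M * ∫ v, unstable R (z i) v ∂(stdGaussian V)| ≤ lam / (16 * n)) :
    WellSpread θ lam R z w where
  quad e := by
    have hn' : (0 : ℝ) < n := by exact_mod_cast hn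
    have e1 : θ ^ 2 * ∑ r, ‖∑ i, e i • feat (z i) (w r)‖ ^ 2 =
        ∑ i, ∑ i', e i * e i' * (θ ^ 2 * ∑ r, ⟪feat (z i) (w r), feat (z i') (w r)⟫) := by
      simp only [norm_sq_sum_smul]
      rw [Finset.sum_comm, Finset.mul_sum]
      refine Finset.sum_congr rfl fun i _ => ?_
      rw [Finset.sum_comm, Finset.mul_sum]
      refine Finset.sum_congr rfl fun i' _ => ?_
      rw [← Finset.mul_sum]
      ring
    have e2 : θ ^ 2 * M * ∑ i, ∑ i', e i * e i' * featGram (z i) (z i') =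
        ∑ i, ∑ i', e i * e i' * (θ ^ 2 * M * featGram (z i) (z i')) := by
      simp only [Finset.mul_sum]
      exact Finset.sum_congr rfl fun i _ => Finset.sum_congr rfl fun i' _ => by ring
    have h3 : θ ^ 2 * M * ∑ i, ∑ i', e i * e i' * featGram (z i) (z i') -
        θ ^ 2 * ∑ r, ‖∑ i, e i • feat (z i) (w r)‖ ^ 2 ≤ lam / 4 * ‖e‖ ^ 2 := by
      rw [e1, e2]
      simp only [← Finset.sum_sub_distrib, ← mul_sub]
      calc _ ≤ ∑ i, ∑ i', |e i| * |e i'| * (lam / (4 * n)) := by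
            refine Finset.sum_le_sum fun i _ => Finset.sum_le_sum fun i' _ => ?_
            refine (le_abs_self _).trans ?_
            rw [abs_mul, abs_mul, abs_sub_comm]
            gcongr
            exact h1 i i'
        _ = (∑ i, |e i|) ^ 2 * (lam / (4 * n)) := by
            rw [sq, Finset.sum_mul_sum, Finset.sum_mul]
            exact Finset.sum_congr rfl fun i _ => by rw [Finset.sum_mul]
        _ ≤ (√n * ‖e‖) ^ 2 * (lam / (4 * n)) := by
            gcongr
            exact sum_abs_le_sqrt_mul_norm e
        _ = _ := by
            rw [mul_pow, Real.sq_sqrt hn'.le]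
            field_simp
    linarith [hquad e]
  unst i := by
    have h3 := (abs_le.mp (h2 i)).2
    have h4 : θ ^ 2 * M * ∫ v, unstable R (z i) v ∂(stdGaussian V) ≤ 1 * R := by
      gcongr
      · exact integral_nonneg fun v => unstable_nonneg _ _ _
      · exact integral_unstable_le (hz i) hR
    -- One half of the instability budget pays for the mean, which is at most R, the other for the
    -- deviation.
    have h5 : lam / (8 * (n : ℝ)) = lam / (16 * n) + lam / (16 * n) := by
      rw [← add_div, show (16 : ℝ) * n = 2 * (8 * n) by ring, ← two_mul,
        mul_div_mul_left _ _ two_ne_zero]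
    linarith

/-- With high probability over the initialization, gradient descent stays close to its starting
point for all times, and the norm of the starting point is close to its typical value. -/
theorem exists_initLaw_event {m N c s D n : ℕ} [NeZero D] (hN : 0 < N) (hmN : m ≤ N)
    (hn : 0 < n) (hc : 0 < c) (x : Fin n → Input c D) (y : Fin n → ℝ)
    (hx : ∀ i j, ‖patch s (x i) j‖ = 1) {B lam R ε : ℝ} (hy : ∀ i, |y i| ≤ B)
    (hlam : 0 < lam) (hlam1 : lam ≤ 1) (hR : 0 < R) (hR1 : R ≤ lam / (16 * n))
    (hB : 8 * n * B ≤ √N * (lam * R)) (hε : 0 < ε)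
    (hquad : ∀ e : EuclideanSpace ℝ (Fin n), lam * ‖e‖ ^ 2 ≤
      (m : ℝ) / N * ∑ i, ∑ i', e i * e i' * featGram (patch s (x i)) (patch s (x i'))) :
    ∃ E : Set ((Fin m → ℝ) × ConvTensor m c s), MeasurableSet E ∧
      (initLaw m c s).real Eᶜ ≤ (n ^ 2 * (16 * n ^ 2 / lam ^ 2) + n * (256 * n ^ 2 / lam ^ 2) +
        n * (64 * n ^ 2 / (lam * R) ^ 2) + gaussianSqVar / ε ^ 2) / N ∧
      ∀ aW ∈ E, (∀ η : ℝ, 0 < η → η ≤ 1 / 8 * lam / n ^ 2 → ∀ t,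
          ‖gradDescent N aW.1 x y η aW.2 t - aW.2‖ ≤ √N * R) ∧
        |‖aW.2‖ ^ 2 - m * (c * (2 * s + 1))| ≤ ε * (N * (c * (2 * s + 1))) := by
  have hn' : (0 : ℝ) < n := by exact_mod_cast hn
  have hN' : (0 : ℝ) < N := by exact_mod_cast hN
  have hc' : (1 : ℝ) ≤ c := by exact_mod_cast hc
  set z : Fin n → ZMod D → Patch c s := fun i => patch s (x i) with hz
  set θ : ℝ := 1 / √(N : ℝ) with hθ
  have hθ0 : 0 < θ := by positivity
  have hθ2 : θ ^ 2 = 1 / N := by rw [hθ, div_pow, Real.sq_sqrt hN'.le, one_pow]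
  have hθM' : θ ^ 2 * m = m / N := by rw [hθ2]; ring
  have hθM : θ ^ 2 * m ≤ 1 := by
    rw [hθM', div_le_one hN']
    exact_mod_cast hmN
  set d : ℝ := c * (2 * s + 1) with hd
  have hd1 : 1 ≤ d := by
    have : (0 : ℝ) ≤ s := by positivity
    nlinarith
  -- Outputs and labels bounded by τ give a residual of norm at most 2τ√n, and then the requirement
  -- 4√n θ ‖residual‖ ≤ lam R holds exactly at this τ.
  set τ : ℝ := lam * R / (8 * n * θ) with hτ
  have hτ0 : 0 < τ := by positivity
  let S0 : Set ((Fin m → ℝ) × ConvTensor m c s) := {aW | ¬ ∀ r, aW.1 r ^ 2 = 1}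
  let A1 : Fin n × Fin n → Set (Fin m → Patch c s) := fun q => {v | lam / (4 * n) ≤
    |θ ^ 2 * ∑ r, ⟪feat (z q.1) (v r), feat (z q.2) (v r)⟫ -
      θ ^ 2 * m * ∫ w, ⟪feat (z q.1) w, feat (z q.2) w⟫ ∂(stdGaussian (Patch c s))|}
  let A2 : Fin n → Set (Fin m → Patch c s) := fun i => {v | lam / (16 * n) ≤
    |θ ^ 2 * ∑ r, unstable R (z i) (v r) -
      θ ^ 2 * m * ∫ w, unstable R (z i) w ∂(stdGaussian (Patch c s))|}
  let S1 : Set ((Fin m → ℝ) × ConvTensor m c s) := ⋃ q, {aW | filter aW.2 ∈ A1 q}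
  let S2 : Set ((Fin m → ℝ) × ConvTensor m c s) := ⋃ i, {aW | filter aW.2 ∈ A2 i}
  let S3 : Set ((Fin m → ℝ) × ConvTensor m c s) := ⋃ i, {aW | τ ≤
    |θ * ∑ r, aW.1 r * pool (z i) (filter aW.2 r)|}
  let S4 : Set ((Fin m → ℝ) × ConvTensor m c s) := {aW | ε * (N * d) ≤
    |‖aW.2‖ ^ 2 - m * (c * (2 * s + 1))|}
  have hS0 : (initLaw m c s).real S0 = 0 := by
    rw [Measure.real, show initLaw m c s S0 = 0 from ae_initLaw_sign_sq m c s,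
      ENNReal.toReal_zero]
  have mfeat : ∀ i i', Measurable fun w : Patch c s => ⟪feat (z i) w, feat (z i') w⟫ :=
    fun i i' => (measurable_feat _).inner (measurable_feat _)
  have hS1 : (initLaw m c s).real S1 ≤ n ^ 2 * (16 * n ^ 2 / lam ^ 2) / N := by
    refine (measureReal_iUnion_fintype_le _).trans ?_
    calc _ ≤ ∑ _q : Fin n × Fin n, θ ^ 2 / (lam / (4 * n)) ^ 2 := by
          refine Finset.sum_le_sum fun q _ => ?_
          rw [initLaw_real_preimage_filter]
          · exact pi_real_abs_sum_sub_ge_le_of_abs_le_one (mfeat q.1 q.2)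
              (abs_inner_feat_le_one (hx q.1) (hx q.2)) hθM (by positivity)
          · refine measurableSet_le measurable_const (Measurable.abs (Measurable.sub_const
              (Measurable.const_mul (Finset.measurable_sum _ fun r _ => ?_) _) _))
            exact (mfeat q.1 q.2).comp (measurable_pi_apply r)
      _ = _ := by
          simp only [Finset.sum_const, Finset.card_univ, Fintype.card_prod, Fintype.card_fin,
            nsmul_eq_mul, hθ2]
          push_cast
          field_simp
          ring
  have hS2 : (initLaw m c s).real S2 ≤ n * (256 * n ^ 2 / lam ^ 2) / N := by
    refine (measureReal_iUnion_fintype_le _).trans ?_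
    calc _ ≤ ∑ _i : Fin n, θ ^ 2 / (lam / (16 * n)) ^ 2 := by
          refine Finset.sum_le_sum fun i _ => ?_
          rw [initLaw_real_preimage_filter]
          · exact pi_real_abs_sum_sub_ge_le_of_abs_le_one (measurable_unstable R (z i))
              (abs_unstable_le_one R (z i)) hθM (by positivity)
          · refine measurableSet_le measurable_const (Measurable.abs (Measurable.sub_const
              (Measurable.const_mul (Finset.measurable_sum _ fun r _ => ?_) _) _))
            exact (measurable_unstable R (z i)).comp (measurable_pi_apply r)
      _ = _ := by
          simp only [Finset.sum_const, Finset.card_univ, Fintype.card_fin, nsmul_eq_mul, hθ2]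
          field_simp
          ring
  have hS3 : (initLaw m c s).real S3 ≤ n * (64 * n ^ 2 / (lam * R) ^ 2) / N := by
    refine (measureReal_iUnion_fintype_le _).trans ?_
    calc _ ≤ ∑ _i : Fin n, 1 / τ ^ 2 :=
          Finset.sum_le_sum fun i _ => initLaw_real_abs_net_ge_le (hx i) hθM hτ0
      _ = n * (64 * n ^ 2 / (lam * R) ^ 2) * θ ^ 2 := by
          simp only [Finset.sum_const, Finset.card_univ, Fintype.card_fin, nsmul_eq_mul, hτ]
          field_simp
          ring
      _ = _ := by rw [hθ2]; ring
  have hS4 : (initLaw m c s).real S4 ≤ gaussianSqVar / ε ^ 2 / N := by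
    refine (initLaw_real_abs_norm_sq_ge_le (by positivity)).trans ?_
    have hv : 0 ≤ gaussianSqVar := variance_nonneg _ _
    have hmN' : (m : ℝ) ≤ N := by exact_mod_cast hmN
    calc _ ≤ N * d * gaussianSqVar / (ε * (N * d)) ^ 2 := by gcongr
      _ = gaussianSqVar / ε ^ 2 / N / d := by field_simp
      _ ≤ _ := div_le_self (by positivity) hd1
  let S := S0 ∪ S1 ∪ S2 ∪ S3 ∪ S4
  -- The measurable hull has the same measure as the bad set, whose own measurability is then not
  -- needed.
  refine ⟨(toMeasurable (initLaw m c s) S)ᶜ, (measurableSet_toMeasurable _ _).compl, ?_, ?_⟩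
  · rw [compl_compl, Measure.real, measure_toMeasurable, ← Measure.real]
    have u1 := measureReal_union_le (μ := initLaw m c s) (S0 ∪ S1 ∪ S2 ∪ S3) S4
    have u2 := measureReal_union_le (μ := initLaw m c s) (S0 ∪ S1 ∪ S2) S3
    have u3 := measureReal_union_le (μ := initLaw m c s) (S0 ∪ S1) S2
    have u4 := measureReal_union_le (μ := initLaw m c s) S0 S1
    simp only [add_div]
    linarith
  · intro aW haW
    have hnot : aW ∉ S := fun h => haW (subset_toMeasurable _ _ h)
    simp only [S, S0, S1, S2, S3, S4, A1, A2, Set.mem_union, Set.mem_iUnion, Set.mem_ofPred_eq,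
      not_or, not_exists, not_not, not_le] at hnot
    obtain ⟨⟨⟨⟨g0, g1⟩, g2⟩, g3⟩, g4⟩ := hnot
    refine ⟨fun η hη hη1 t => ?_, g4.le⟩
    have hws : WellSpread θ lam R z (filter aW.2) :=
      WellSpread.of_deviation hn hx hθM hlam hR.le hR1 (by rw [hθM']; exact hquad)
        (fun i i' => (g1 (i, i')).le) (fun i => (g2 i).le)
    have hres : 4 * √n * θ * ‖residual θ aW.1 z y (filter aW.2)‖ ≤ lam * R := by
      have hi : ∀ i, |residual θ aW.1 z y (filter aW.2) i| ≤ 2 * τ := by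
        intro i
        have hBτ : B ≤ τ := by
          rw [hτ, le_div_iff₀ (by positivity)]
          calc B * (8 * n * θ) = (8 * n * B) / √N := by rw [hθ]; ring
            _ ≤ lam * R := by rw [div_le_iff₀ (by positivity)]; linarith
        calc _ ≤ |θ * ∑ r, aW.1 r * pool (z i) (filter aW.2 r)| + |y i| := abs_sub _ _
          _ ≤ τ + τ := add_le_add (g3 i).le ((hy i).trans hBτ)
          _ = _ := by ring
      have hnorm : ‖residual θ aW.1 z y (filter aW.2)‖ ≤ √n * (2 * τ) := by
        refine le_of_sq_le_sq ?_ (by positivity)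
        rw [EuclideanSpace.real_norm_sq_eq]
        calc _ ≤ ∑ _i : Fin n, (2 * τ) ^ 2 := by
              refine Finset.sum_le_sum fun i _ => ?_
              rw [← sq_abs]
              gcongr
              exact hi i
          _ = _ := by simp [mul_pow]
      calc _ ≤ 4 * √n * θ * (√n * (2 * τ)) := by gcongr
        _ = 8 * (√n * √n) * θ * τ := by ring
        _ = lam * R := by
          rw [Real.mul_self_sqrt hn'.le, hτ]
          field_simp
    have hmove : ∀ r, ‖filter (gradDescent N aW.1 x y η aW.2 t) r - filter aW.2 r‖ ≤ R :=
      WellSpread.norm_gradDescent_sub_le (w := fun t => filter (gradDescent N aW.1 x y η aW.2 t))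
        hn hθ0.le hθM hlam hlam1 hη hη1 g0 hx y hws hres
        (fun t r => filter_gradDescent_succ N aW.1 x y η aW.2 t r) t
    refine le_of_sq_le_sq ?_ (by positivity)
    rw [norm_sq_eq_sum_filter, mul_pow, Real.sq_sqrt hN'.le]
    calc _ ≤ ∑ _r : Fin m, R ^ 2 := by
          refine Finset.sum_le_sum fun r _ => ?_
          rw [filter_sub]
          gcongr
          exact hmove r
      _ = m * R ^ 2 := by simp
      _ ≤ _ := by gcongr

end GoodEvent

/-! ### The limiting Gram matrix and its least eigenvalue -/

section Gram

variable {c D n s : ℕ} [NeZero D]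

/-- The double sum over positions is the inner product of two averaged features, so the eigenvalue
hypothesis speaks of the expected kernel of the descent. -/
lemma gramLimit_apply (q : ℝ) (x : Fin n → Input c D) (i i' : Fin n) :
    gramLimit s q x i i' = q * featGram (patch s (x i)) (patch s (x i')) := by
  rw [featGram, ← integral_const_mul, gramLimit, Matrix.of_apply]
  congr 1
  ext w
  simp only [feat, real_inner_smul_left, real_inner_smul_right, sum_inner, inner_sum, ZMod.card,
    Finset.mul_sum]
  rw [Finset.sum_comm]
  exact Finset.sum_congr rfl fun j _ => Finset.sum_congr rfl fun j' _ => by ring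

lemma gramLimit_isHermitian (q : ℝ) (x : Fin n → Input c D) :
    (gramLimit s q x).IsHermitian := by
  ext i i'
  rw [Matrix.conjTranspose_apply, gramLimit_apply, gramLimit_apply, star_trivial]
  simp only [featGram, real_inner_comm]

end Gram

/-- The least eigenvalue of a real symmetric matrix bounds its quadratic form from below. -/
lemma isLeast_eigenvalue_mul_norm_sq_le {n : ℕ} {G : Matrix (Fin n) (Fin n) ℝ}
    (hG : G.IsHermitian) {lam : ℝ}
    (h : IsLeast {μ : ℝ | Module.End.HasEigenvalue (Matrix.toLin' G) μ} lam)
    (e : EuclideanSpace ℝ (Fin n)) : lam * ‖e‖ ^ 2 ≤ ∑ i, ∑ i', e i * e i' * G i i' := by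
  have hA : (G - lam • (1 : Matrix (Fin n) (Fin n) ℝ)).IsHermitian := by
    refine hG.sub ?_
    ext i i'
    simp [Matrix.one_apply, eq_comm]
  have hps : (G - lam • (1 : Matrix (Fin n) (Fin n) ℝ)).PosSemidef := by
    refine hA.posSemidef_iff_eigenvalues_nonneg.mpr fun j => ?_
    have hv := hA.mulVec_eigenvectorBasis j
    have hne : (hA.eigenvectorBasis j).ofLp ≠ 0 := fun h0 => by
      have h1 := hA.eigenvectorBasis.orthonormal.ne_zero j
      exact h1 (by ext k; exact congrFun h0 k)
    -- An eigenvalue μ of G - lam gives the eigenvalue μ + lam of G, which is at least lam by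
    -- minimality.
    rw [Matrix.sub_mulVec, Matrix.smul_mulVec, Matrix.one_mulVec, sub_eq_iff_eq_add,
      ← add_smul] at hv
    have := h.2 (Module.End.hasEigenvalue_of_hasEigenvector
      (Module.End.hasEigenvector_iff.mpr ⟨Module.End.mem_eigenspace_iff.mpr
        (by rw [Matrix.toLin'_apply]; exact hv), hne⟩))
    simpa using this
  have h0 := hps.dotProduct_mulVec_nonneg e.ofLp
  rw [Matrix.sub_mulVec, Matrix.smul_mulVec, Matrix.one_mulVec, dotProduct_sub] at h0
  simp only [star_trivial, dotProduct, Matrix.mulVec, Pi.smul_apply, smul_eq_mul] at h0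
  rw [EuclideanSpace.real_norm_sq_eq, Finset.mul_sum]
  simp only [Finset.mul_sum] at h0
  have e1 : ∑ i, ∑ i', e i * (G i i' * e i') = ∑ i, ∑ i', e i * e i' * G i i' :=
    Finset.sum_congr rfl fun i _ => Finset.sum_congr rfl fun i' _ => by ring
  have e2 : ∑ i, e i * (lam * e i) = ∑ i, lam * e i ^ 2 :=
    Finset.sum_congr rfl fun i _ => by ring
  rw [e1, e2] at h0
  linarith

/-! ### Lower bounds for the rotation distance from norms -/

section RotationDistance

lemma norm_zeroPad {m M c s : ℕ} (κ : Fin M ↪ Fin m) (V : ConvTensor M c s) :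
    ‖zeroPad κ V‖ = ‖V‖ := by
  have h : ∀ {k : ℕ} (U : ConvTensor k c s), ‖U‖ ^ 2 = ∑ kl, ∑ r, U (r, kl) ^ 2 := fun U => by
    rw [EuclideanSpace.real_norm_sq_eq, Fintype.sum_prod_type_right]
  rw [← sq_eq_sq₀ (norm_nonneg _) (norm_nonneg _), h, h]
  refine Finset.sum_congr rfl fun kl _ => ?_
  refine (Fintype.sum_of_injective κ κ.injective (fun r => V (r, kl) ^ 2)
    (fun r => zeroPad κ V (r, kl) ^ 2) (fun r hr => ?_) fun r => ?_).symm
  · simp only [zeroPad]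
    rw [Function.extend_apply' _ _ _ fun ⟨a, ha⟩ => hr ⟨a, ha⟩]
    simp
  · simp only [zeroPad]
    rw [κ.injective.extend_apply]

lemma minRotDist_nonneg {m c s : ℕ} (A B : ConvTensor m c s) : 0 ≤ minRotDist A B :=
  Real.iInf_nonneg fun _ => div_nonneg (norm_nonneg _) (Real.sqrt_nonneg _)

/-- Reverse triangle inequality: the bound involves Q only through `‖Q A‖ = ‖A‖`. -/
lemma le_minRotDist {m c s : ℕ} {A B : ConvTensor m c s} {t : ℝ} (hA : 0 < ‖A‖) (hB : 0 < ‖B‖)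
    (h : t * √(‖A‖ * ‖B‖) ≤ ‖B‖ - ‖A‖) : t ≤ minRotDist A B := by
  refine le_ciInf fun Q => ?_
  rw [normDist, LinearIsometryEquiv.norm_map, le_div_iff₀ (by positivity)]
  refine h.trans ?_
  rw [norm_sub_rev, ← Q.norm_map A]
  exact norm_sub_norm_le _ _

/-- Factor u² - κ and use u + √κ ≥ √κ ≥ κ; passing from squared norms to norms thus loses a factor κ
at most. -/
lemma abs_sub_sqrt_le {u κ ε η : ℝ} (hu : 0 ≤ u) (hκ : 0 < κ) (hκ1 : κ ≤ 1) (hη : 0 ≤ η)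
    (hε : ε ≤ κ * η) (h : |u ^ 2 - κ| ≤ ε) : |u - √κ| ≤ η := by
  have hs : 0 < √κ := Real.sqrt_pos.mpr hκ
  have hle : κ ≤ √κ := by
    nlinarith [Real.sq_sqrt hκ.le, Real.sqrt_le_one.mpr hκ1]
  have e : u ^ 2 - κ = (u - √κ) * (u + √κ) := by
    nlinarith [Real.sq_sqrt hκ.le]
  rw [e, abs_mul, abs_of_pos (by positivity : 0 < u + √κ)] at h
  have h1 : |u - √κ| * √κ ≤ η * √κ := by
    calc _ ≤ |u - √κ| * (u + √κ) := by gcongr; linarith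
      _ ≤ κ * η := h.trans hε
      _ ≤ √κ * η := by gcongr
      _ = _ := mul_comm _ _
  exact le_of_mul_le_mul_right h1 hs

/-- If `‖A‖` and `‖B‖` are, up to small relative errors, in the ratio `√(1 - p)`, then the
rotation distance of `A` and `B` is at least `p / 2`. -/
lemma half_le_minRotDist {m c s : ℕ} {A B : ConvTensor m c s} {p L : ℝ} (hp : 0 < p) (hp1 : p < 1)
    (hL : 0 < L) (hA : |‖A‖ / L - √(1 - p)| ≤ p ^ 2 * (1 - p) / 16)
    (hB : |‖B‖ / L - 1| ≤ p ^ 2 * (1 - p) / 16) : p / 2 ≤ minRotDist A B := by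
  set r := √(1 - p) with hr
  have hr0 : 0 < r := Real.sqrt_pos.mpr (by linarith)
  have hr1 : r ≤ 1 := Real.sqrt_le_one.mpr (by linarith)
  have hr2 : r ^ 2 = 1 - p := Real.sq_sqrt (by linarith)
  set η := p ^ 2 * (1 - p) / 16 with hη
  have hη1 : η ≤ p ^ 2 / 16 := by rw [hη]; nlinarith [sq_nonneg p]
  have hη2 : η < r := by
    have : p ^ 2 ≤ 1 := by nlinarith
    rw [hη, ← hr2]
    nlinarith [sq_nonneg r]
  have hη0 : 0 ≤ η := by rw [hη, ← hr2]; positivity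
  set α := ‖A‖ / L with hα
  set β := ‖B‖ / L with hβ
  have hAα : ‖A‖ = α * L := by rw [hα, div_mul_cancel₀ _ hL.ne']
  have hBβ : ‖B‖ = β * L := by rw [hβ, div_mul_cancel₀ _ hL.ne']
  obtain ⟨a1, a2⟩ := abs_le.mp hA
  obtain ⟨b1, b2⟩ := abs_le.mp hB
  have hα0 : 0 < α := by linarith
  have hβ0 : 0 < β := by nlinarith
  refine le_minRotDist (by rw [hAα]; positivity) (by rw [hBβ]; positivity) ?_
  have hamgm : √(‖A‖ * ‖B‖) ≤ (α + β) / 2 * L := by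
    refine Real.sqrt_le_iff.mpr ⟨by positivity, ?_⟩
    rw [hAα, hBβ]
    have : 0 ≤ (α - β) ^ 2 * L ^ 2 := by positivity
    nlinarith
  have hkey : p / 2 * ((α + β) / 2) ≤ β - α := by
    have h1 : p / 2 * ((α + β) / 2) ≤ p / 2 * ((r + 1) / 2 + η) := by gcongr; linarith
    -- Without errors the gap is (1 - r)² (3 + r) / 4. The errors total (2 + p/2) η, with η ≤ p²/16
    -- ≤ (1 - r)²/4, and 2 + p/2 < 3.
    have h2 : p / 2 * ((r + 1) / 2 + η) ≤ 1 - r - 2 * η := by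
      have hpr : p = (1 - r) * (1 + r) := by nlinarith
      have h3 : (1 - r) - p / 2 * ((r + 1) / 2) = (1 - r) ^ 2 * (3 + r) / 4 := by rw [hpr]; ring
      have h4 : p ^ 2 ≤ 4 * (1 - r) ^ 2 := by rw [hpr]; nlinarith [sq_nonneg (1 - r)]
      have h5 : 0 ≤ (1 - r) ^ 2 * r := by positivity
      nlinarith
    linarith
  calc _ ≤ p / 2 * ((α + β) / 2 * L) := by gcongr
    _ = p / 2 * ((α + β) / 2) * L := by ring
    _ ≤ (β - α) * L := by gcongr
    _ = _ := by rw [hAα, hBβ]; ring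

end RotationDistance

/-! ### Error bookkeeping and the required width -/

/-- The norm of the trained tensor, relative to `√(N d)`. -/
lemma abs_norm_div_sub_sqrt_le {m c s : ℕ} {W W₀ : ConvTensor m c s} {N d R κ η : ℝ}
    (hN : 0 < N) (hd : 1 ≤ d) (hκ : 0 < κ) (hκ1 : κ ≤ 1) (hη : 0 ≤ η) (hR : R ≤ η)
    (hR0 : 0 ≤ R)
    {ε : ℝ} (hε : ε ≤ κ * η) (hmove : ‖W - W₀‖ ≤ √N * R)
    (hinit : |‖W₀‖ ^ 2 - κ * N * d| ≤ ε * (N * d)) :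
    |‖W‖ / √(N * d) - √κ| ≤ 2 * η := by
  have hL : 0 < √(N * d) := Real.sqrt_pos.mpr (by positivity)
  have hL2 : √(N * d) ^ 2 = N * d := Real.sq_sqrt (by positivity)
  have h1 : |‖W₀‖ / √(N * d) - √κ| ≤ η := by
    refine abs_sub_sqrt_le (by positivity) hκ hκ1 hη hε ?_
    have e : (‖W₀‖ / √(N * d)) ^ 2 - κ = (‖W₀‖ ^ 2 - κ * N * d) / (N * d) := by
      rw [div_pow, hL2]
      field_simp
    rw [e, abs_div, abs_of_pos (by positivity : 0 < N * d), div_le_iff₀ (by positivity)]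
    exact hinit
  have h2 : |‖W‖ / √(N * d) - ‖W₀‖ / √(N * d)| ≤ η := by
    rw [← sub_div, abs_div, abs_of_pos hL, div_le_iff₀ hL]
    calc _ ≤ ‖W - W₀‖ := abs_norm_sub_norm_le _ _
      _ ≤ √N * R := hmove
      _ ≤ √(N * d) * η := by
        gcongr
        exact le_mul_of_one_le_right hN.le hd
      _ = _ := mul_comm _ _
  calc _ = |(‖W‖ / √(N * d) - ‖W₀‖ / √(N * d)) + (‖W₀‖ / √(N * d) - √κ)| := by
        congr 1; ring
    _ ≤ _ := (abs_add_le _ _).trans (by linarith)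

/-- A variable with a law is only almost everywhere measurable, so the preimage is shrunk by a null
set to become measurable. -/
lemma exists_measurableSet_of_hasLaw {Ω X : Type*} [MeasurableSpace Ω] [MeasurableSpace X]
    {P : Measure Ω} {ν : Measure X} {f : Ω → X} (hf : HasLaw f ν P) {E : Set X}
    (hE : MeasurableSet E) :
    ∃ F : Set Ω, MeasurableSet F ∧ P.real Fᶜ = ν.real Eᶜ ∧ ∀ ω ∈ F, f ω ∈ E := by
  obtain ⟨F, hFs, hF, hFE⟩ :=
    (hf.aemeasurable.nullMeasurableSet_preimage hE).exists_measurable_subset_ae_eq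
  refine ⟨F, hF, ?_, fun ω hω => hFs hω⟩
  rw [measureReal_congr hFE.compl]
  exact hf.measureReal_eq hE.compl

/-- The width from which the approximations hold, up to the factor `(n / lam) ^ 5 / δ ^ 2`. -/
def widthConst (B ρ ε : ℝ) : ℝ :=
  2 * (272 + 64 / ρ ^ 2 + gaussianSqVar / ε ^ 2) + 64 * B ^ 2 / ρ ^ 2

lemma widthConst_pos (B ρ ε : ℝ) : 0 < widthConst B ρ ε := by
  have : 0 ≤ gaussianSqVar := variance_nonneg _ _
  unfold widthConst
  positivity

/-- The failure probability and the width requirement of `exists_initLaw_event` for wide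
networks. -/
lemma failure_le_of_width {B ρ ε lam n N δ : ℝ} (hρ : 0 < ρ) (hn : 1 ≤ n)
    (hlam : 0 < lam) (hlam1 : lam ≤ 1) (hδ : 0 < δ) (hδ1 : δ < 1) (hN : 0 < N)
    (hε : 0 < ε) (h : widthConst B ρ ε * (n / lam) ^ 5 / δ ^ 2 ≤ N) :
    8 * n * B ≤ √N * (lam * (ρ * lam / n)) ∧
    (n ^ 2 * (16 * n ^ 2 / lam ^ 2) + n * (256 * n ^ 2 / lam ^ 2) +
      n * (64 * n ^ 2 / (lam * (ρ * lam / n)) ^ 2) + gaussianSqVar / ε ^ 2) / N ≤ δ / 2 := by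
  have hn0 : 0 < n := by linarith
  have hv : 0 ≤ gaussianSqVar := variance_nonneg _ _
  have hT : 1 ≤ n / lam := by rw [le_div_iff₀ hlam]; linarith
  set T := (n / lam) ^ 5 with hTdef
  -- Every requirement is a sum of such quotients. The exponent 5 is forced by n · n² / (lam R)²
  -- with R of order lam / n, which is of order n⁵ / lam⁴.
  have hmono : ∀ a b : ℕ, a ≤ 5 → b ≤ 5 → n ^ a / lam ^ b ≤ T := by
    intro a b ha hb
    rw [hTdef, div_pow]
    exact div_le_div₀ (by positivity) (pow_le_pow_right₀ hn ha) (by positivity)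
      (pow_le_pow_of_le_one hlam.le hlam1 hb)
  have hT0 : 0 < T := by positivity
  have hC := widthConst_pos B ρ ε
  have hN1 : widthConst B ρ ε * T / δ ≤ N := by
    refine le_trans ?_ h
    gcongr
    nlinarith
  have hN2 : widthConst B ρ ε * T ≤ N := by
    refine le_trans ?_ hN1
    rw [le_div_iff₀ hδ]
    nlinarith [mul_pos hC hT0]
  constructor
  · have h1 : (8 * n ^ 2 * B / (lam ^ 2 * ρ)) ^ 2 ≤ N := by
      calc _ = 64 * B ^ 2 / ρ ^ 2 * (n ^ 4 / lam ^ 4) := by field_simp; ring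
        _ ≤ 64 * B ^ 2 / ρ ^ 2 * T := by
          gcongr
          exact hmono 4 4 (by norm_num) (by norm_num)
        _ ≤ widthConst B ρ ε * T := by
          gcongr
          unfold widthConst
          have : 0 ≤ 2 * (272 + 64 / ρ ^ 2 + gaussianSqVar / ε ^ 2) := by positivity
          linarith
        _ ≤ N := hN2
    have h2 := Real.le_sqrt_of_sq_le h1
    calc 8 * n * B = 8 * n ^ 2 * B / (lam ^ 2 * ρ) * (lam * (ρ * lam / n)) := by field_simp
      _ ≤ _ := by gcongr
  · rw [div_le_iff₀ hN]
    calc _ = 16 * (n ^ 4 / lam ^ 2) + 256 * (n ^ 3 / lam ^ 2) + 64 / ρ ^ 2 * (n ^ 5 / lam ^ 4) +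
          gaussianSqVar / ε ^ 2 * (n ^ 0 / lam ^ 0) := by field_simp
      _ ≤ 16 * T + 256 * T + 64 / ρ ^ 2 * T + gaussianSqVar / ε ^ 2 * T := by
          gcongr
          · exact hmono 4 2 (by norm_num) (by norm_num)
          · exact hmono 3 2 (by norm_num) (by norm_num)
          · exact hmono 5 4 (by norm_num) (by norm_num)
          · exact hmono 0 0 (by norm_num) (by norm_num)
      _ = 2 * (272 + 64 / ρ ^ 2 + gaussianSqVar / ε ^ 2) * T * (1 / 2) := by ring
      _ ≤ widthConst B ρ ε * T * (1 / 2) := by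
          gcongr
          unfold widthConst
          have : 0 ≤ 64 * B ^ 2 / ρ ^ 2 := by positivity
          linarith
      _ ≤ N * δ * (1 / 2) := by
          rw [div_le_iff₀ hδ] at hN1
          exact mul_le_mul_of_nonneg_right hN1 (by norm_num)
      _ = _ := by ring

end ORCNN

end

/-! ### Assembly -/

theorem theorem2 :
    ∃ (K : ℕ) (c₀ : ℝ), 0 < c₀ ∧
    ∀ (p B : ℝ), 0 ≤ p → p < 1 → 0 ≤ B →
    ∃ C : ℝ, 0 < C ∧
    ∀ (n c D s : ℕ) [NeZero D] (x : Fin n → ORCNN.Input c D) (y : Fin n → ℝ) (lam : ℝ),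
      0 < n →
      (∀ i j, ‖ORCNN.patch s (x i) j‖ = 1) →
      (∀ i, |y i| ≤ B) →
      0 < lam →
      IsLeast {μ : ℝ | Module.End.HasEigenvalue
        (Matrix.toLin' (ORCNN.gramLimit s (1 - p) x)) μ} lam →
    ∀ (δ : ℝ), 0 < δ → δ < 1 →
    ∀ (m M : ℕ), C * ((n : ℝ) / lam) ^ K / δ ^ 2 ≤ (m : ℝ) → (M : ℝ) = (1 - p) * (m : ℝ) →
    ∀ (ηpre ηfin : ℝ), 0 < ηpre → ηpre ≤ c₀ * lam / (n : ℝ) ^ 2 →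
      0 < ηfin → ηfin ≤ c₀ * lam / (n : ℝ) ^ 2 →
    ∀ {Ω : Type*} [MeasurableSpace Ω] (P : MeasureTheory.Measure Ω)
      [MeasureTheory.IsProbabilityMeasure P]
      (a₀ : Ω → Fin m → ℝ) (W₀ : Ω → ORCNN.ConvTensor m c s) (κ : Ω → (Fin M ↪ Fin m)),
      ProbabilityTheory.HasLaw (fun ω => (a₀ ω, W₀ ω)) (ORCNN.initLaw m c s) P →
      ProbabilityTheory.HasLaw
        (fun ω => (a₀ ω ∘ κ ω, ORCNN.keepFilters (κ ω) (W₀ ω))) (ORCNN.initLaw M c s) P →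
    ∃ E : Set Ω, MeasurableSet E ∧ 1 - δ ≤ P.real E ∧
      ∀ ω ∈ E, ∀ tpre tfin : ℕ,
        p / 2 ≤ ORCNN.minRotDist
          (ORCNN.zeroPad (κ ω) (ORCNN.gradDescent m (a₀ ω ∘ κ ω) x y ηfin
            (ORCNN.keepFilters (κ ω) (W₀ ω)) tfin))
          (ORCNN.gradDescent m (a₀ ω) x y ηpre (W₀ ω) tpre) := by
  refine ⟨5, 1 / 8, by norm_num, fun p B hp0 hp1 hB => ?_⟩
  -- Half of the tolerance in `half_le_minRotDist`: initialization and training each use one η. The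
  -- factor 1 - p in ε offsets the loss in `abs_sub_sqrt_le` with κ = 1 - p.
  set η : ℝ := p ^ 2 * (1 - p) / 32 with hη
  set ε : ℝ := (1 - p) * η with hε
  refine ⟨ORCNN.widthConst B η ε, ORCNN.widthConst_pos _ _ _, ?_⟩
  intro n c D s _ x y lam hn hx hy hlam hleast δ hδ hδ1 m M hm hM ηpre ηfin hpre hpre' hfin hfin'
    Ω _ P _ a₀ W₀ κ hlaw hlaw'
  -- For p = 0 the tolerances degenerate to 0, but the claim is only nonnegativity.
  rcases hp0.eq_or_lt with rfl | hp
  · refine ⟨Set.univ, MeasurableSet.univ, by simp [hδ.le], fun ω _ _ _ => ?_⟩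
    rw [zero_div]
    exact ORCNN.minRotDist_nonneg _ _
  have hq : 0 < 1 - p := by linarith
  have hη0 : 0 < η := by rw [hη]; positivity
  have hη1 : η ≤ 1 / 32 := by
    have : p ^ 2 ≤ 1 := by nlinarith
    rw [hη]
    nlinarith
  have hε0 : 0 < ε := by positivity
  have hn1 : (1 : ℝ) ≤ n := by exact_mod_cast hn
  have hquad : ∀ e : EuclideanSpace ℝ (Fin n), lam * ‖e‖ ^ 2 ≤ (1 - p) *
      ∑ i, ∑ i', e i * e i' * ORCNN.featGram (ORCNN.patch s (x i)) (ORCNN.patch s (x i')) := by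
    intro e
    refine (ORCNN.isLeast_eigenvalue_mul_norm_sq_le
      (ORCNN.gramLimit_isHermitian (1 - p) x) hleast e).trans_eq ?_
    simp only [ORCNN.gramLimit_apply, Finset.mul_sum]
    exact Finset.sum_congr rfl fun i _ => Finset.sum_congr rfl fun i' _ => by ring
  have hlam1 : lam ≤ 1 := by
    -- Tested on a basis vector, the form is a diagonal entry, at most 1 because features have norm
    -- at most 1.
    have h := hquad (EuclideanSpace.single ⟨0, hn⟩ 1)
    have hle : ORCNN.featGram (ORCNN.patch s (x ⟨0, hn⟩)) (ORCNN.patch s (x ⟨0, hn⟩)) ≤ 1 := by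
      have h1 := MeasureTheory.norm_integral_le_of_norm_le_const
        (μ := ProbabilityTheory.stdGaussian (ORCNN.Patch c s)) (C := 1)
        (f := fun w => inner ℝ (ORCNN.feat (ORCNN.patch s (x ⟨0, hn⟩)) w)
          (ORCNN.feat (ORCNN.patch s (x ⟨0, hn⟩)) w)) (.of_forall fun w =>
          ORCNN.abs_inner_feat_le_one (hx ⟨0, hn⟩) (hx ⟨0, hn⟩) w)
      simp only [MeasureTheory.probReal_univ, mul_one] at h1
      exact (le_abs_self _).trans h1
    simp [PiLp.single_apply] at h
    nlinarith
  have hm0 : (0 : ℝ) < m := lt_of_lt_of_le (by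
    have := ORCNN.widthConst_pos B η ε
    positivity) hm
  have hmpos : 0 < m := by exact_mod_cast hm0
  have hMm : M ≤ m := by
    have : (M : ℝ) ≤ m := by rw [hM]; exact mul_le_of_le_one_left hm0.le (by linarith)
    exact_mod_cast this
  -- Without channels all patches would be zero instead of unit vectors.
  have hc : 0 < c := by
    rcases Nat.eq_zero_or_pos c with rfl | h
    · have h0 := hx ⟨0, hn⟩ 0
      rw [Subsingleton.elim (ORCNN.patch s (x ⟨0, hn⟩) 0) 0, norm_zero] at h0
      exact absurd h0 zero_ne_one
    · exact h
  obtain ⟨hwidth, hfail⟩ := ORCNN.failure_le_of_width hη0 hn1 hlam hlam1 hδ hδ1 hm0 hε0 hm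
  set R : ℝ := η * lam / n with hR
  have hR0 : 0 < R := by positivity
  have hRη : R ≤ η := by
    rw [hR, div_le_iff₀ (by positivity)]
    gcongr
    linarith
  have hR1 : R ≤ lam / (16 * n) := by
    rw [hR, div_le_div_iff₀ (by positivity) (by positivity)]
    calc η * lam * (16 * n) = 16 * η * (lam * n) := by ring
      _ ≤ 1 * (lam * n) := by
        gcongr
        linarith
      _ = lam * n := one_mul _
  obtain ⟨Epre, hEpre, hPpre, hgood⟩ := ORCNN.exists_initLaw_event hmpos le_rfl hn hc x y hx hy
    hlam hlam1 hR0 hR1 hwidth hε0 fun e => by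
      -- The full network has the kernel without the factor 1 - p. As the form is nonnegative,
      -- dropping this factor only increases it, so the same lam serves both networks.
      rw [div_self hm0.ne', one_mul]
      have h := hquad e
      have h0 : 0 ≤ lam * ‖e‖ ^ 2 := by positivity
      refine h.trans (mul_le_of_le_one_left ?_ (by linarith))
      exact nonneg_of_mul_nonneg_right (h0.trans h) hq
  obtain ⟨Efin, hEfin, hPfin, hgood'⟩ := ORCNN.exists_initLaw_event hmpos hMm hn hc x y hx hy
    hlam hlam1 hR0 hR1 hwidth hε0 fun e => by
      rw [hM, mul_div_cancel_right₀ _ hm0.ne']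
      exact hquad e
  obtain ⟨F, hF, hPF, hFE⟩ := ORCNN.exists_measurableSet_of_hasLaw hlaw hEpre
  obtain ⟨F', hF', hPF', hFE'⟩ := ORCNN.exists_measurableSet_of_hasLaw hlaw' hEfin
  refine ⟨F ∩ F', hF.inter hF', ?_, fun ω hω tpre tfin => ?_⟩
  · have h1 := MeasureTheory.measureReal_union_le (μ := P) Fᶜ F'ᶜ
    rw [← Set.compl_inter, MeasureTheory.probReal_compl_eq_one_sub (hF.inter hF'), hPF, hPF'] at h1
    linarith
  · obtain ⟨g1, g2⟩ := hgood _ (hFE ω hω.1)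
    obtain ⟨g1', g2'⟩ := hgood' _ (hFE' ω hω.2)
    have hd : (1 : ℝ) ≤ c * (2 * s + 1) := by
      have hc' : (1 : ℝ) ≤ c := by exact_mod_cast hc
      have : (0 : ℝ) ≤ s := by positivity
      exact one_le_mul_of_one_le_of_one_le hc' (by linarith)
    have h2η : 2 * η = p ^ 2 * (1 - p) / 16 := by rw [hη]; ring
    refine ORCNN.half_le_minRotDist hp hp1
      (L := √((m : ℝ) * (c * (2 * s + 1)))) (Real.sqrt_pos.mpr (by positivity)) ?_ ?_
    · rw [ORCNN.norm_zeroPad, ← h2η]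
      refine ORCNN.abs_norm_div_sub_sqrt_le hm0 hd hq (by linarith) hη0.le hRη hR0.le le_rfl
        (g1' ηfin hfin hfin' tfin) ?_
      rw [← hM]
      exact g2'
    · rw [← h2η]
      have h := ORCNN.abs_norm_div_sub_sqrt_le (κ := 1) (ε := ε) hm0 hd one_pos le_rfl hη0.le hRη
        hR0.le (by
          rw [hε]; exact mul_le_mul_of_nonneg_right (by linarith) hη0.le) (g1 ηpre hpre hpre' tpre) (by rw [one_mul]; exact g2)
      rwa [Real.sqrt_one] at h
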